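/- Let $\rho\in\mathbb R$, $\mu\neq 0$. For $\rho\ne0$ let $\langle x,y\rangle=x_0y_0+x_1y_1+x_2y_2+\operatorname{sign}(\rho)\,x_3y_3$ on $\mathbb R^4$. Let $\mathbb M^3(\rho)$ be the space form of curvature $\rho$: $\mathbb R^3\times\{0\}$ with the Euclidean metric if $\rho=0$, the sphere $\langle x,x\rangle=1/\rho$ if $\rho>0$, the hyperboloid sheet $\langle x,x\rangle=1/\rho$, $x_3>0$, if $\rho<0$, and let $\mathbb M^2(\rho)=\mathbb M^3(\rho)\cap\{x_0=0\}$, a totally geodesic surface. Let $\widetilde\nabla$ be the Levi-Civita connection. Let $I$ be an open interval and $\gamma:I\to\mathbb M^2(\rho)$ a smooth unit speed curve with Frenet frame $\{T,N,B\}$ in $\mathbb M^3(\rho)$ and zero torsion ($N$ a smooth unit normal of $\gamma$ in $\mathbb M^2(\rho)$, $B=T\times N$), with curvature $\kappa$, $\widetilde\nabla_TT=\kappa N$, nowhere zero (of either sign) and not constant. Put $$\mathcal K=\Big(1-\frac{\mu}{\kappa}\Big)e^{\mu/\kappa}N,\qquad \mathcal J=\widetilde\nabla_T\mathcal K+(\kappa-2\mu)e^{\mu/\kappa}T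 .$$ Suppose that $\gamma$ is a critical curve of $\mathbf\Theta_\mu(\gamma)=\int_\gamma\kappa\,e^{\mu/\kappa}\,ds$, that is, that its Euler-Lagrange field vanishes: $\mathcal E(\gamma)=\widetilde\nabla_T\mathcal J+\rho\,\mathcal K=0$ on $I$. Then the field $\mathcal I=\big(1-\frac{\mu}{\kappa}\big)e^{\mu/\kappa}B$ along $\gamma$ extends to a Killing field of $\mathbb M^3(\rho)$ with a complete flow. Moreover, for every Killing field of $\mathbb M^3(\rho)$ extending $\mathcal I$, with flow $\{\phi_t\}_{t\in\mathbb R}$, and for $S_\gamma=\{\phi_t(\gamma(s)):s\in I,\ t\in\mathbb R\}$, the following hold. 1. $S_\gamma$ is a rotational surface: it is invariant under $\{\phi_t\}$, and $\{\phi_t\}$ is a one-parameter group of rotations of $\mathbb M^3(\rho)$. This means that $\{\phi_t\}$ is a nontrivial one-parameter group of isometries that fixes pointwise a complete geodesic of $\mathbb M^3(\rho)$ or, only if $\rho<0$, that acts by linear maps of $\mathbb R^4$ fixing pointwise a two-dimensional linear subspace (the spherical, parabolic and hyperbolic rotations of $\mathbb H^3(\rho)$). If $$e^{2b}\big(b^2(b')^2+\rho(1-b)^2+\mu^2\big)>0\quad\text{on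 } I,\qquad b=\mu/\kappa$$ (which is automatic if $\rho\ge0$), then $\{\phi_t\}$ fixes a complete geodesic pointwise. 2. On the open set $\{(s,t)\in I\times\mathbb R:\kappa(s)\neq\mu\}$, that is, where $\mathcal I\neq0$, the map $X(s,t)=\phi_t(\gamma(s))$ is an immersion, and the surface has constant astigmatism with $c=1/\mu$: for a suitable smooth unit normal and labelling, its principal curvatures $\kappa_1,\kappa_2$ are continuous, nowhere zero, and satisfy $$\frac1{\kappa_1}-\frac1{\kappa_2}=\frac1\mu .$$ -/

import Mathlib

open scoped ContDiff

noncomputable section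

namespace SpaceForm

/-- The ambient coordinate space with coordinates `(x 0, x 1, x 2, x 3)`. -/
abbrev V : Type := Fin 4 → ℝ

/-- The ambient symmetric form: Euclidean for `ρ > 0`, Lorentzian for `ρ < 0`; for `ρ = 0` it is the
Euclidean product of the first three coordinates, the only ones used by `ℝ³ × {0}`. -/
def form (ρ : ℝ) (u v : V) : ℝ :=
  u 0 * v 0 + u 1 * v 1 + u 2 * v 2 + Real.sign ρ * (u 3 * v 3)

/-- The three-dimensional space form of curvature `ρ`: the hyperplane `x 3 = 0` if `ρ = 0`, the round
sphere `⟨x, x⟩ = 1 / ρ` if `ρ > 0`, the upper sheet of the hyperboloid `⟨x, x⟩ = 1 / ρ` if `ρ < 0`.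
Its Riemannian metric is the restriction of `form ρ` to the tangent spaces. -/
def M3 (ρ : ℝ) : Set V :=
  {x | (ρ = 0 → x 3 = 0) ∧ (ρ ≠ 0 → form ρ x x = 1 / ρ) ∧ (ρ < 0 → 0 < x 3)}

/-- The two-dimensional space form, as the totally geodesic surface `x 0 = 0` of `M3 ρ`. -/
def M2 (ρ : ℝ) : Set V := {x | x ∈ M3 ρ ∧ x 0 = 0}

/-- `v` is tangent to `M3 ρ` at `x`. -/
def IsTangent (ρ : ℝ) (x v : V) : Prop :=
  (ρ = 0 → v 3 = 0) ∧ (ρ ≠ 0 → form ρ v x = 0)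

/-- Orthogonal projection of the ambient space onto the tangent space of `M3 ρ` at `x ∈ M3 ρ`
(for `ρ = 0` it is only applied to vectors that are already tangent). -/
def tangProj (ρ : ℝ) (x v : V) : V := v - (ρ * form ρ v x) • x

/-- Levi-Civita derivative along the curve `c` in `M3 ρ` of the vector field `W` along `c`: the
tangential part of the ambient derivative. -/
def covDeriv (ρ : ℝ) (c W : ℝ → V) (s : ℝ) : V := tangProj ρ (c s) (deriv W s)

/-- `γ` is a smooth unit speed curve in `M2 ρ`, viewed in `M3 ρ`, with nowhere zero curvature `κ`
with respect to the unit normal `N` of `γ` in `M2 ρ`; `{γ', N, B}` is its Frenet frame in `M3 ρ`,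
with zero torsion. Both choices of the sign of `N`, and both orientations of `M3 ρ`, are allowed. -/
structure IsPlanarFrenetCurve (ρ : ℝ) (I : Set ℝ) (γ N B : ℝ → V) (κ : ℝ → ℝ) : Prop where
  smooth_curve : ContDiffOn ℝ ∞ γ I
  smooth_normal : ContDiffOn ℝ ∞ N I
  smooth_binormal : ContDiffOn ℝ ∞ B I
  smooth_curvature : ContDiffOn ℝ ∞ κ I
  mem : ∀ s ∈ I, γ s ∈ M2 ρ
  unit_speed : ∀ s ∈ I, form ρ (deriv γ s) (deriv γ s) = 1
  normal_tangent : ∀ s ∈ I, IsTangent ρ (γ s) (N s) ∧ N s 0 = 0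
  normal_unit : ∀ s ∈ I, form ρ (N s) (N s) = 1
  normal_orthogonal : ∀ s ∈ I, form ρ (N s) (deriv γ s) = 0
  binormal_tangent : ∀ s ∈ I, IsTangent ρ (γ s) (B s)
  binormal_unit : ∀ s ∈ I, form ρ (B s) (B s) = 1
  binormal_orthogonal : ∀ s ∈ I, form ρ (B s) (deriv γ s) = 0 ∧ form ρ (B s) (N s) = 0
  frenet_tangent : ∀ s ∈ I, covDeriv ρ γ (deriv γ) s = κ s • N s
  frenet_normal : ∀ s ∈ I, covDeriv ρ γ N s = -(κ s) • deriv γ s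
  frenet_binormal : ∀ s ∈ I, covDeriv ρ γ B s = 0
  curvature_ne_zero : ∀ s ∈ I, κ s ≠ 0

/-- The function `(1 - μ / κ) exp (μ / κ)`. -/
def speedFactor (μ : ℝ) (κ : ℝ → ℝ) (s : ℝ) : ℝ :=
  (1 - μ / κ s) * Real.exp (μ / κ s)

/-- The vector field `K = (1 - μ / κ) exp (μ / κ) N`. -/
def fieldK (μ : ℝ) (N : ℝ → V) (κ : ℝ → ℝ) (s : ℝ) : V := speedFactor μ κ s • N s

/-- The vector field `J = ∇_T K + (κ - 2 μ) exp (μ / κ) T`. -/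
def fieldJ (ρ μ : ℝ) (γ N : ℝ → V) (κ : ℝ → ℝ) (s : ℝ) : V :=
  covDeriv ρ γ (fieldK μ N κ) s + ((κ s - 2 * μ) * Real.exp (μ / κ s)) • deriv γ s

/-- The Euler-Lagrange vector field `E = ∇_T J + ρ K` of the energy `∫ κ exp (μ / κ) ds`: the
integrand of the first variation in the direction `W` is `⟨E, W⟩`, up to boundary terms. -/
def fieldE (ρ μ : ℝ) (γ N : ℝ → V) (κ : ℝ → ℝ) (s : ℝ) : V :=
  covDeriv ρ γ (fieldJ ρ μ γ N κ) s + ρ • fieldK μ N κ s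

/-- Critical curves of the energy `∫ κ exp (μ / κ) ds`: those with `E = 0`. -/
def IsCriticalCurve (ρ μ : ℝ) (I : Set ℝ) (γ N : ℝ → V) (κ : ℝ → ℝ) : Prop :=
  ∀ s ∈ I, fieldE ρ μ γ N κ s = 0

/-- The vector field `(1 - μ / κ) exp (μ / κ) B` along the curve. -/
def fieldI (μ : ℝ) (B : ℝ → V) (κ : ℝ → ℝ) (s : ℝ) : V := speedFactor μ κ s • B s

/-- The quantity `exp (2 b) (b² b'² + ρ (1 - b)² + μ²)` with `b = μ / κ`. -/
def firstIntegral (ρ μ : ℝ) (κ : ℝ → ℝ) (s : ℝ) : ℝ :=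
  Real.exp (2 * (μ / κ s)) *
    ((μ / κ s) ^ 2 * (deriv (fun r => μ / κ r) s) ^ 2 + ρ * (1 - μ / κ s) ^ 2 + μ ^ 2)

/-- Killing fields of `M3 ρ`: smooth tangent fields with `⟨∇_v ξ, v⟩ = 0` for all tangent vectors `v`,
the vectors `v` being given as velocities of smooth curves in `M3 ρ`. -/
structure IsKillingField (ρ : ℝ) (ξ : V → V) : Prop where
  smooth : ContDiffOn ℝ ∞ ξ (M3 ρ)
  tangent : ∀ x ∈ M3 ρ, IsTangent ρ x (ξ x)
  killing : ∀ c : ℝ → V, ContDiff ℝ ∞ c → (∀ s, c s ∈ M3 ρ) →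
    ∀ s, form ρ (covDeriv ρ c (fun r => ξ (c r)) s) (deriv c s) = 0

/-- `φ` is the (complete) flow on `M3 ρ` of the vector field `ξ`. -/
structure IsFlow (ρ : ℝ) (ξ : V → V) (φ : ℝ → V → V) : Prop where
  zero : ∀ x ∈ M3 ρ, φ 0 x = x
  mem : ∀ t, ∀ x ∈ M3 ρ, φ t x ∈ M3 ρ
  hasDerivAt : ∀ t, ∀ x ∈ M3 ρ, HasDerivAt (fun r => φ r x) (ξ (φ t x)) t

/-- One-parameter groups of Riemannian isometries of `M3 ρ`. -/
structure IsOneParamIsometryGroup (ρ : ℝ) (ψ : ℝ → V → V) : Prop where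
  mem : ∀ t, ∀ x ∈ M3 ρ, ψ t x ∈ M3 ρ
  zero : ∀ x ∈ M3 ρ, ψ 0 x = x
  add : ∀ s t, ∀ x ∈ M3 ρ, ψ (s + t) x = ψ s (ψ t x)
  continuous : ∀ x ∈ M3 ρ, Continuous (fun t => ψ t x)
  smooth : ∀ t, ContDiffOn ℝ ∞ (ψ t) (M3 ρ)
  isometry : ∀ t, ∀ c : ℝ → V, ContDiff ℝ ∞ c → (∀ s, c s ∈ M3 ρ) →
    ∀ s, form ρ (deriv (fun r => ψ t (c r)) s) (deriv (fun r => ψ t (c r)) s) =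
      form ρ (deriv c s) (deriv c s)

/-- Complete unit speed geodesics of `M3 ρ`. -/
structure IsGeodesic (ρ : ℝ) (α : ℝ → V) : Prop where
  smooth : ContDiff ℝ ∞ α
  mem : ∀ s, α s ∈ M3 ρ
  unit_speed : ∀ s, form ρ (deriv α s) (deriv α s) = 1
  geodesic : ∀ s, covDeriv ρ α (deriv α) s = 0

/-- The group leaves a geodesic (the rotation axis) pointwise fixed. -/
def FixesGeodesic (ρ : ℝ) (ψ : ℝ → V → V) : Prop :=
  ∃ α : ℝ → V, IsGeodesic ρ α ∧ ∀ t s, ψ t (α s) = α s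

/-- The group acts by linear maps that leave a two-dimensional linear subspace of the ambient
space pointwise fixed. -/
def FixesPlane (ρ : ℝ) (ψ : ℝ → V → V) : Prop :=
  ∃ (P : Submodule ℝ V) (L : ℝ → V →ₗ[ℝ] V), Module.finrank ℝ P = 2 ∧
    (∀ t, ∀ x ∈ M3 ρ, ψ t x = L t x) ∧ ∀ t, ∀ x ∈ P, L t x = x

/-- One-parameter groups of rotations of `M3 ρ`: nontrivial one-parameter groups of isometries that
leave a geodesic pointwise fixed or, in hyperbolic space, a two-dimensional linear subspace of the
Lorentzian ambient space (this includes the parabolic and the hyperbolic rotations, for which the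
subspace does not meet hyperbolic space). -/
structure IsRotationGroup (ρ : ℝ) (ψ : ℝ → V → V) : Prop where
  isometries : IsOneParamIsometryGroup ρ ψ
  nontrivial : ∃ t, ∃ x ∈ M3 ρ, ψ t x ≠ x
  fixes : FixesGeodesic ρ ψ ∨ (ρ < 0 ∧ FixesPlane ρ ψ)

/-- `S` is a rotational surface of `M3 ρ`, with `ψ` as group of rotations. -/
structure IsRotationalSurface (ρ : ℝ) (ψ : ℝ → V → V) (S : Set V) : Prop where
  subset : S ⊆ M3 ρ
  rotations : IsRotationGroup ρ ψ
  invariant : ∀ t, ψ t '' S = S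

/-- `η` is a smooth unit normal field in `M3 ρ` along the parametrized surface `X` on `U`. -/
structure IsUnitNormal (ρ : ℝ) (U : Set (ℝ × ℝ)) (X η : ℝ × ℝ → V) : Prop where
  smooth : ContDiffOn ℝ ∞ η U
  tangent : ∀ p ∈ U, IsTangent ρ (X p) (η p)
  unit : ∀ p ∈ U, form ρ (η p) (η p) = 1
  normal : ∀ p ∈ U, ∀ v : ℝ × ℝ, form ρ (η p) (fderiv ℝ X p v) = 0

/-- `k₁` and `k₂` are the principal curvatures at `p` of the surface `X` with unit normal `η`: the
shape operator `dX v ↦ -∇_v η` has a basis of eigenvectors with the eigenvalues `k₁`, `k₂`. -/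
def ArePrincipalCurvatures (ρ : ℝ) (X η : ℝ × ℝ → V) (p : ℝ × ℝ) (k₁ k₂ : ℝ) : Prop :=
  ∃ v w : ℝ × ℝ, LinearIndependent ℝ ![v, w] ∧
    -tangProj ρ (X p) (fderiv ℝ η p v) = k₁ • fderiv ℝ X p v ∧
    -tangProj ρ (X p) (fderiv ℝ η p w) = k₂ • fderiv ℝ X p w

/-- `X` is, on the open set `U`, a smooth immersed surface of `M3 ρ` that can be oriented so that its
principal curvatures are nowhere zero and satisfy `1 / κ₁ - 1 / κ₂ = c`. -/
structure IsConstantAstigmatism (ρ : ℝ) (U : Set (ℝ × ℝ)) (X : ℝ × ℝ → V) (c : ℝ) : Prop where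
  isOpen : IsOpen U
  smooth : ContDiffOn ℝ ∞ X U
  mem : ∀ p ∈ U, X p ∈ M3 ρ
  immersion : ∀ p ∈ U, Function.Injective (fderiv ℝ X p)
  astigmatism : ∃ (η : ℝ × ℝ → V) (κ₁ κ₂ : ℝ × ℝ → ℝ), IsUnitNormal ρ U X η ∧
    ContinuousOn κ₁ U ∧ ContinuousOn κ₂ U ∧
    ∀ p ∈ U, ArePrincipalCurvatures ρ X η p (κ₁ p) (κ₂ p) ∧
      κ₁ p ≠ 0 ∧ κ₂ p ≠ 0 ∧ 1 / κ₁ p - 1 / κ₂ p = c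

/-- The parametrization `X (s, t) = φ_t (γ (s))`. -/
def evolution (φ : ℝ → V → V) (γ : ℝ → V) (p : ℝ × ℝ) : V := φ p.2 (γ p.1)

end SpaceForm

end

open SpaceForm

/-!
The function `f = (1 - μ / κ) exp (μ / κ)` has a companion `h = μ exp (μ / κ)` with `h' = -κ f'`. In
terms of these, the Euler–Lagrange equation `E = 0` reads `f'' + ρ f = κ h`, and together with the
Frenet equations `γ'' = κ N - ρ γ`, `N' = -κ γ'`, `B' = 0` in the ambient space it says exactly that
the vector `w = ρ f γ + f' γ' + h N` is constant (`hasDerivAt_conservedVector`). So are `B`, which is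
plus or minus the first basis vector, and `c = f - ⟨γ, w⟩`, which vanishes unless `ρ = 0`.
Hence the field `f B` along `γ` is the restriction of
`ξ x = (⟨x, w⟩ + c) B - ⟨x, B⟩ w`,
an infinitesimal rotation in the plane of `w` and `B`. Its flow is explicit in terms of trigonometric
functions of curvature `a = ⟨w, w⟩`, and `a` is the first integral
`exp (2 b) (b² b'² + ρ (1 - b)² + μ²)`. The fixed points of the flow are the solutions of
`⟨x, w⟩ + c = 0` and `⟨x, B⟩ = 0`: in the space form they make up a geodesic if `a > 0`
(`fixesGeodesic`), and for `ρ < 0` they always make up a plane of the ambient space (`fixesPlane`).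

Any Killing field extending `f B` agrees with `ξ` on the space form (`killing_eqOn`). Indeed, the
product `⟨η, α'⟩` of a Killing field `η` with the velocity of a geodesic `α` is constant, so that
`⟨η x, y - x⟩ + ⟨η y, x - y⟩ = 0` for all points `x`, `y`. If `η` vanishes along `γ`, take `y = γ s` and
differentiate twice in `s`: every value `η x` is orthogonal to the frame of the slice `x 0 = 0`, hence
a multiple of the first basis vector, and the relation at two points shows that the multiple is zero.

Finally, the swept out surface and its unit normal are
`X (s, t) = γ + f (S B - D w)` and `η (s, t) = N + h (S B - D w)`
with the same functions `S`, `D` of `t`. From `N' = -κ γ'` and `h' = -κ f'` one reads off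
`∂ₛ η = -κ ∂ₛ X`, while `∂ₜ η = (h / f) ∂ₜ X`. So the principal curvatures are `κ` and `-h / f`, and
`1 / κ + f / h = 1 / μ` (`isConstantAstigmatism`).
-/

noncomputable section

namespace SpaceForm

/-! ### Trigonometric functions of a given curvature -/

/-- The cosine of curvature `a`: the solution of `C'' = -a C` with `C 0 = 1`, `C' 0 = 0`. -/
def cosK (a t : ℝ) : ℝ :=
  if 0 < a then Real.cos (√a * t) else Real.cosh (√(-a) * t)

/-- The sine of curvature `a`: the solution of `S'' = -a S` with `S 0 = 0`, `S' 0 = 1`. -/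
def sinK (a t : ℝ) : ℝ :=
  if 0 < a then Real.sin (√a * t) / √a
  else if a < 0 then Real.sinh (√(-a) * t) / √(-a) else t

/-- The primitive of `sinK a` vanishing at `0`, that is `(1 - cosK a) / a` continued to `a = 0`. -/
def verK (a t : ℝ) : ℝ :=
  if a = 0 then t ^ 2 / 2 else (1 - cosK a t) / a

lemma cosK_zero (a : ℝ) : cosK a 0 = 1 := by simp [cosK]

lemma sinK_zero (a : ℝ) : sinK a 0 = 0 := by simp [sinK]

lemma verK_zero (a : ℝ) : verK a 0 = 0 := by simp [verK, cosK_zero]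

lemma mul_verK (a t : ℝ) : a * verK a t = 1 - cosK a t := by
  rcases eq_or_ne a 0 with rfl | h
  · simp [verK, cosK]
  · rw [verK, if_neg h]; field_simp

lemma cosK_sq_add (a t : ℝ) : cosK a t ^ 2 + a * sinK a t ^ 2 = 1 := by
  rcases lt_trichotomy a 0 with h | rfl | h
  · have h0 : 0 < √(-a) := Real.sqrt_pos.2 (by linarith)
    have h1 : √(-a) ^ 2 = -a := Real.sq_sqrt (by linarith)
    rw [cosK, sinK, if_neg h.not_gt, if_neg h.not_gt, if_pos h, div_pow, h1, Real.cosh_sq]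
    have := h.ne
    field_simp
    ring
  · simp [cosK]
  · have h1 : √a ^ 2 = a := Real.sq_sqrt h.le
    rw [cosK, sinK, if_pos h, if_pos h, div_pow, h1, mul_div_cancel₀ _ h.ne',
      Real.cos_sq_add_sin_sq]

lemma hasDerivAt_cosK (a t : ℝ) : HasDerivAt (cosK a) (-a * sinK a t) t := by
  rcases lt_trichotomy a 0 with h | rfl | h
  · have h0 : 0 < √(-a) := Real.sqrt_pos.2 (by linarith)
    have h1 : √(-a) ^ 2 = -a := Real.sq_sqrt (by linarith)
    have e : cosK a = fun t => Real.cosh (√(-a) * t) := by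
      funext t; rw [cosK, if_neg h.not_gt]
    rw [e, sinK, if_neg h.not_gt, if_pos h]
    refine (((hasDerivAt_id t).const_mul (√(-a))).cosh).congr_deriv ?_
    simp only [id]
    field_simp
    rw [h1]
    ring
  · have e : cosK 0 = fun _ => 1 := by funext t; simp [cosK]
    rw [e]; simpa using hasDerivAt_const t (1 : ℝ)
  · have h0 : 0 < √a := Real.sqrt_pos.2 h
    have h1 : √a ^ 2 = a := Real.sq_sqrt h.le
    have e : cosK a = fun t => Real.cos (√a * t) := by
      funext t; rw [cosK, if_pos h]
    rw [e, sinK, if_pos h]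
    refine (((hasDerivAt_id t).const_mul (√a)).cos).congr_deriv ?_
    simp only [id]
    field_simp
    rw [h1]
    ring

lemma hasDerivAt_sinK (a t : ℝ) : HasDerivAt (sinK a) (cosK a t) t := by
  rcases lt_trichotomy a 0 with h | rfl | h
  · have h0 : 0 < √(-a) := Real.sqrt_pos.2 (by linarith)
    have e : sinK a = fun t => Real.sinh (√(-a) * t) / √(-a) := by
      funext t; rw [sinK, if_neg h.not_gt, if_pos h]
    rw [e, cosK, if_neg h.not_gt]
    refine ((((hasDerivAt_id t).const_mul (√(-a))).sinh).div_const (√(-a))).congr_deriv ?_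
    simp only [id]
    field_simp
  · have e : sinK 0 = fun t => t := by funext t; simp [sinK]
    rw [e]; exact (hasDerivAt_id' t).congr_deriv (by simp [cosK])
  · have h0 : 0 < √a := Real.sqrt_pos.2 h
    have e : sinK a = fun t => Real.sin (√a * t) / √a := by
      funext t; rw [sinK, if_pos h]
    rw [e, cosK, if_pos h]
    refine ((((hasDerivAt_id t).const_mul (√a)).sin).div_const (√a)).congr_deriv ?_
    simp only [id]
    field_simp

lemma hasDerivAt_verK (a t : ℝ) : HasDerivAt (verK a) (sinK a t) t := by
  rcases eq_or_ne a 0 with rfl | h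
  · have e : verK 0 = fun t => t ^ 2 / 2 := by funext t; simp [verK]
    rw [e]
    exact (((hasDerivAt_id' t).pow 2).div_const 2).congr_deriv (by simp [sinK])
  · have e : verK a = fun t => (1 - cosK a t) / a := by funext t; rw [verK, if_neg h]
    rw [e]
    exact (((hasDerivAt_cosK a t).const_sub 1).div_const a).congr_deriv (by field_simp)

lemma sinK_sq (a t : ℝ) : sinK a t ^ 2 = verK a t * (1 + cosK a t) := by
  rcases eq_or_ne a 0 with rfl | h
  · simp [verK, cosK, sinK]; ring
  · apply mul_left_cancel₀ h
    linear_combination cosK_sq_add a t - (1 + cosK a t) * mul_verK a t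

lemma contDiff_sinK (a : ℝ) : ContDiff ℝ ∞ (sinK a) := by
  unfold sinK
  split_ifs <;> fun_prop

lemma contDiff_cosK (a : ℝ) : ContDiff ℝ ∞ (cosK a) := by
  unfold cosK
  split_ifs <;> fun_prop

lemma contDiff_verK (a : ℝ) : ContDiff ℝ ∞ (verK a) := by
  unfold verK
  have := contDiff_cosK a
  split_ifs <;> fun_prop

/-- A point of the conic `p ^ 2 + a q ^ 2 = 1` with `q ≥ 0`, on the branch through `(1, 0)` if
`a ≤ 0`, is a value of `(cosK a, sinK a)`. -/
lemma exists_cosK_sinK {a p q : ℝ} (h : p ^ 2 + a * q ^ 2 = 1) (hq : 0 ≤ q)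
    (hp : a ≤ 0 → 0 < p) : ∃ t, cosK a t = p ∧ sinK a t = q := by
  rcases lt_trichotomy a 0 with ha | rfl | ha
  · have h0 : 0 < √(-a) := Real.sqrt_pos.2 (by linarith)
    have h1 : √(-a) ^ 2 = -a := Real.sq_sqrt (by linarith)
    refine ⟨Real.arsinh (√(-a) * q) / √(-a), ?_, ?_⟩
    · rw [cosK, if_neg ha.not_gt, mul_div_cancel₀ _ h0.ne', Real.cosh_arsinh]
      rw [show 1 + (√(-a) * q) ^ 2 = p ^ 2 by rw [mul_pow, h1]; linarith,
        Real.sqrt_sq (hp ha.le).le]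
    · rw [sinK, if_neg ha.not_gt, if_pos ha, mul_div_cancel₀ _ h0.ne', Real.sinh_arsinh]
      field_simp
  · refine ⟨q, ?_, by simp [sinK]⟩
    have := hp le_rfl
    simp only [cosK, lt_irrefl, if_false, neg_zero, Real.sqrt_zero, zero_mul, Real.cosh_zero]
    nlinarith
  · have h0 : 0 < √a := Real.sqrt_pos.2 ha
    have h1 : √a ^ 2 = a := Real.sq_sqrt ha.le
    have hp2 : p ^ 2 ≤ 1 := by nlinarith [mul_nonneg ha.le (sq_nonneg q)]
    obtain ⟨hl, hr⟩ := abs_le.1 ((sq_le_one_iff_abs_le_one p).1 hp2)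
    refine ⟨Real.arccos p / √a, ?_, ?_⟩
    · rw [cosK, if_pos ha, mul_div_cancel₀ _ h0.ne', Real.cos_arccos hl hr]
    · rw [sinK, if_pos ha, mul_div_cancel₀ _ h0.ne', Real.sin_arccos]
      have : 1 - p ^ 2 = (√a * q) ^ 2 := by rw [mul_pow, h1]; linarith
      rw [this, Real.sqrt_sq (by positivity)]
      field_simp

/-! ### The ambient form -/

variable {ρ : ℝ}

lemma form_comm (ρ : ℝ) (u v : V) : form ρ u v = form ρ v u := by
  simp only [form]; ring

lemma form_add_left (ρ : ℝ) (u v w : V) : form ρ (u + v) w = form ρ u w + form ρ v w := by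
  simp only [form, Pi.add_apply]; ring

lemma form_sub_left (ρ : ℝ) (u v w : V) : form ρ (u - v) w = form ρ u w - form ρ v w := by
  simp only [form, Pi.sub_apply]; ring

lemma form_smul_left (ρ r : ℝ) (u v : V) : form ρ (r • u) v = r * form ρ u v := by
  simp only [form, Pi.smul_apply, smul_eq_mul]; ring

lemma form_neg_left (ρ : ℝ) (u v : V) : form ρ (-u) v = -form ρ u v := by
  simp only [form, Pi.neg_apply]; ring

lemma form_add_right (ρ : ℝ) (u v w : V) : form ρ u (v + w) = form ρ u v + form ρ u w := by
  simp only [form, Pi.add_apply]; ring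

lemma form_sub_right (ρ : ℝ) (u v w : V) : form ρ u (v - w) = form ρ u v - form ρ u w := by
  simp only [form, Pi.sub_apply]; ring

lemma form_smul_right (ρ r : ℝ) (u v : V) : form ρ u (r • v) = r * form ρ u v := by
  simp only [form, Pi.smul_apply, smul_eq_mul]; ring

lemma form_zero_left (ρ : ℝ) (v : V) : form ρ 0 v = 0 := by simp [form]

lemma form_zero_right (ρ : ℝ) (v : V) : form ρ v 0 = 0 := by simp [form]

lemma _root_.HasDerivAt.form {u v : ℝ → V} {u' v' : V} {s : ℝ} (ρ : ℝ)
    (hu : HasDerivAt u u' s) (hv : HasDerivAt v v' s) :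
    HasDerivAt (fun r => form ρ (u r) (v r)) (form ρ u' (v s) + form ρ (u s) v') s := by
  rw [hasDerivAt_pi] at hu hv
  refine (((((hu 0).mul (hv 0)).add ((hu 1).mul (hv 1))).add ((hu 2).mul (hv 2))).add
    (((hu 3).mul (hv 3)).const_mul (Real.sign ρ))).congr_deriv ?_
  simp only [SpaceForm.form]; ring

lemma _root_.ContDiffOn.form {E : Type*} [NormedAddCommGroup E] [NormedSpace ℝ E] {s : Set E}
    {u v : E → V} (ρ : ℝ) (hu : ContDiffOn ℝ ∞ u s) (hv : ContDiffOn ℝ ∞ v s) :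
    ContDiffOn ℝ ∞ (fun x => form ρ (u x) (v x)) s := by
  rw [contDiffOn_pi] at hu hv
  exact ((((hu 0).mul (hv 0)).add ((hu 1).mul (hv 1))).add ((hu 2).mul (hv 2))).add
    (((hu 3).mul (hv 3)).const_smul (Real.sign ρ))

lemma form_self_of_mem (hρ : ρ ≠ 0) {x : V} (hx : x ∈ M3 ρ) : ρ * form ρ x x = 1 := by
  rw [hx.2.1 hρ]; field_simp

lemma tangProj_of_isTangent {x v : V} (h : IsTangent ρ x v) : tangProj ρ x v = v := by
  rcases eq_or_ne ρ 0 with rfl | hρ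
  · simp [tangProj]
  · simp [tangProj, h.2 hρ]

/-- The form is positive definite on the tangent spaces. -/
lemma form_self_pos {x v : V} (hx : x ∈ M3 ρ) (hv : IsTangent ρ x v) (h0 : v ≠ 0) :
    0 < form ρ v v := by
  have hne : v 0 ≠ 0 ∨ v 1 ≠ 0 ∨ v 2 ≠ 0 ∨ v 3 ≠ 0 := by
    by_contra! h
    apply h0
    funext i
    fin_cases i
    exacts [h.1, h.2.1, h.2.2.1, h.2.2.2]
  rcases lt_trichotomy ρ 0 with h | rfl | h
  · have e1 := hx.2.1 h.ne
    have e2 := hv.2 h.ne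
    have e3 : 1 / ρ < 0 := one_div_neg.2 h
    rw [form, Real.sign_of_neg h] at e1 e2 ⊢
    set A := x 0 * x 0 + x 1 * x 1 + x 2 * x 2 with hA
    set P := v 0 * v 0 + v 1 * v 1 + v 2 * v 2 with hP
    -- Cauchy–Schwarz for the space-like coordinates
    have hcs : (x 3 * v 3) ^ 2 ≤ A * P := by
      have : x 3 * v 3 = v 0 * x 0 + v 1 * x 1 + v 2 * x 2 := by linarith
      rw [this]
      nlinarith [sq_nonneg (v 0 * x 1 - v 1 * x 0), sq_nonneg (v 0 * x 2 - v 2 * x 0),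
        sq_nonneg (v 1 * x 2 - v 2 * x 1)]
    have hA0 : 0 ≤ A := by rw [hA]; simp only [← sq]; positivity
    have hP0 : 0 ≤ P := by rw [hP]; simp only [← sq]; positivity
    have hAx : A < x 3 * x 3 := by linarith
    by_contra! hle
    have hPv : P ≤ v 3 * v 3 := by linarith
    have hv3 : v 3 = 0 := by
      by_contra hv3
      have : 0 < v 3 * v 3 := mul_self_pos.2 hv3
      nlinarith
    have hP00 : P = 0 := by rw [hv3] at hPv; linarith
    have h0' : v 0 = 0 := by
      nlinarith [mul_self_nonneg (v 0), mul_self_nonneg (v 1), mul_self_nonneg (v 2)]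
    have h1' : v 1 = 0 := by
      nlinarith [mul_self_nonneg (v 0), mul_self_nonneg (v 1), mul_self_nonneg (v 2)]
    have h2' : v 2 = 0 := by
      nlinarith [mul_self_nonneg (v 0), mul_self_nonneg (v 1), mul_self_nonneg (v 2)]
    simp_all
  · have := hv.1 rfl
    have hne' : v 0 ≠ 0 ∨ v 1 ≠ 0 ∨ v 2 ≠ 0 := by simpa [this] using hne
    simp only [form, Real.sign_zero, zero_mul, add_zero]
    rcases hne' with h | h | h <;> have := mul_self_pos.2 h <;>
      nlinarith [mul_self_nonneg (v 0), mul_self_nonneg (v 1), mul_self_nonneg (v 2)]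
  · simp only [form, Real.sign_of_pos h, one_mul]
    rcases hne with h | h | h | h <;> have := mul_self_pos.2 h <;>
      nlinarith [mul_self_nonneg (v 0), mul_self_nonneg (v 1), mul_self_nonneg (v 2),
        mul_self_nonneg (v 3)]

/-- A connectedness argument: a continuous path on the two-sheeted hyperboloid starting on the upper
sheet stays there. -/
lemma pos_of_path {c : ℝ → V} (hρ : ρ < 0) (hc : Continuous c)
    (hf : ∀ s, form ρ (c s) (c s) = 1 / ρ) (h0 : 0 < c 0 3) (s : ℝ) : 0 < c s 3 := by
  by_contra! h
  have hc3 : Continuous fun s => c s 3 := (continuous_apply 3).comp hc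
  obtain ⟨r, hr⟩ := mem_range_of_exists_le_of_exists_ge hc3 ⟨s, h⟩ ⟨0, h0.le⟩
  have e1 := hf r
  have e3 : 1 / ρ < 0 := one_div_neg.2 hρ
  simp only at hr
  rw [form, Real.sign_of_neg hρ, hr] at e1
  nlinarith [mul_self_nonneg (c r 0), mul_self_nonneg (c r 1), mul_self_nonneg (c r 2)]

/-! ### Geodesics -/

lemma hasDerivAt_geodesicCurve (ρ : ℝ) (x e : V) (s : ℝ) :
    HasDerivAt (fun s => cosK ρ s • x + sinK ρ s • e) ((-ρ * sinK ρ s) • x + cosK ρ s • e) s :=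
  ((hasDerivAt_cosK ρ s).smul_const x).add ((hasDerivAt_sinK ρ s).smul_const e)

lemma contDiff_geodesicCurve (ρ : ℝ) (x e : V) :
    ContDiff ℝ ∞ (fun s => cosK ρ s • x + sinK ρ s • e) := by
  have := contDiff_cosK ρ
  have := contDiff_sinK ρ
  fun_prop

lemma geodesicCurve_mem {x e : V} (hx : x ∈ M3 ρ) (he : IsTangent ρ x e) (h1 : form ρ e e = 1)
    (s : ℝ) : cosK ρ s • x + sinK ρ s • e ∈ M3 ρ := by
  have key : ρ ≠ 0 → ∀ s, form ρ (cosK ρ s • x + sinK ρ s • e) (cosK ρ s • x + sinK ρ s • e)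
      = 1 / ρ := by
    intro h s
    have h2 := he.2 h
    have h3 := form_self_of_mem h hx
    have h4 := cosK_sq_add ρ s
    simp only [form_add_left, form_add_right, form_smul_left, form_smul_right, h1, h2,
      form_comm ρ x e]
    rw [eq_div_iff h]
    linear_combination cosK ρ s ^ 2 * h3 + h4
  refine ⟨fun h => ?_, fun h => key h s, fun h => ?_⟩
  · simp [hx.1 h, he.1 h]
  · refine pos_of_path h (contDiff_geodesicCurve ρ x e).continuous (key h.ne) ?_ s
    simpa [cosK_zero, sinK_zero] using hx.2.2 h

lemma isGeodesic_geodesicCurve {x e : V} (hx : x ∈ M3 ρ) (he : IsTangent ρ x e)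
    (h1 : form ρ e e = 1) : IsGeodesic ρ (fun s => cosK ρ s • x + sinK ρ s • e) := by
  have hd : deriv (fun s => cosK ρ s • x + sinK ρ s • e) =
      fun s => (-ρ * sinK ρ s) • x + cosK ρ s • e :=
    funext fun s => (hasDerivAt_geodesicCurve ρ x e s).deriv
  refine ⟨contDiff_geodesicCurve ρ x e, geodesicCurve_mem hx he h1, fun s => ?_, fun s => ?_⟩
  · rw [hd]
    simp only [form_add_left, form_add_right, form_smul_left, form_smul_right, h1,
      form_comm ρ x e]
    rcases eq_or_ne ρ 0 with rfl | h
    · linear_combination cosK_sq_add 0 s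
    · rw [he.2 h]
      linear_combination cosK_sq_add ρ s + ρ * sinK ρ s ^ 2 * form_self_of_mem h hx
  · rw [hd]
    have hd2 : deriv (fun s => (-ρ * sinK ρ s) • x + cosK ρ s • e) s =
        (-ρ) • (cosK ρ s • x + sinK ρ s • e) := by
      have := (((hasDerivAt_sinK ρ s).const_mul (-ρ)).smul_const x).add
        ((hasDerivAt_cosK ρ s).smul_const e)
      exact this.deriv.trans (by module)
    rw [covDeriv, hd2]
    rcases eq_or_ne ρ 0 with rfl | h
    · simp [tangProj]
    · have := form_self_of_mem h (geodesicCurve_mem hx he h1 s)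
      rw [tangProj, form_smul_left, ← sub_smul,
        show -ρ - ρ * (-ρ * form ρ (cosK ρ s • x + sinK ρ s • e) (cosK ρ s • x + sinK ρ s • e)) = 0 by
          linear_combination ρ * this, zero_smul]

/-- Two points of `M3 ρ` lie on a geodesic, unless they are equal or antipodal. -/
lemma exists_geodesicCurve_through {x y : V} (hx : x ∈ M3 ρ) (hy : y ∈ M3 ρ) (hxy : y ≠ x)
    (hxy' : 0 < ρ → y ≠ -x) : ∃ (e : V) (s : ℝ), IsTangent ρ x e ∧ form ρ e e = 1 ∧
      y = cosK ρ s • x + sinK ρ s • e := by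
  -- the initial direction is the tangential part `v` of `y`, with `p` the normal coefficient
  obtain ⟨p, hp1, hp2, hp0⟩ : ∃ p : ℝ, IsTangent ρ x (y - p • x) ∧
      p ^ 2 + ρ * form ρ (y - p • x) (y - p • x) = 1 ∧ (ρ ≤ 0 → 0 < p) := by
    rcases eq_or_ne ρ 0 with rfl | h
    · exact ⟨1, ⟨fun _ => by simp [hx.1 rfl, hy.1 rfl], fun h => absurd rfl h⟩, by ring, by simp⟩
    · have h1 := form_self_of_mem h hx
      have h2 := form_self_of_mem h hy
      refine ⟨ρ * form ρ y x, ⟨fun h' => absurd h' h, fun _ => ?_⟩, ?_, fun h' => ?_⟩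
      · rw [form_sub_left, form_smul_left]
        linear_combination -form ρ y x * h1
      · simp only [form_sub_left, form_sub_right, form_smul_left, form_smul_right, form_comm ρ x y]
        linear_combination h2 + (ρ * form ρ y x) ^ 2 * h1
      · have hneg := lt_of_le_of_ne h' h
        have e1 := hx.2.1 h
        have e2 := hy.2.1 h
        have h3 : 1 / ρ < 0 := one_div_neg.2 hneg
        have hx3 := hx.2.2 hneg
        have hy3 := hy.2.2 hneg
        apply mul_pos_of_neg_of_neg hneg
        rw [form, Real.sign_of_neg hneg] at e1 e2 ⊢
        set A := x 0 * x 0 + x 1 * x 1 + x 2 * x 2 with hA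
        set P := y 0 * y 0 + y 1 * y 1 + y 2 * y 2 with hP
        have hA0 : 0 ≤ A := by rw [hA]; simp only [← sq]; positivity
        have hP0 : 0 ≤ P := by rw [hP]; simp only [← sq]; positivity
        have hcs : (y 0 * x 0 + y 1 * x 1 + y 2 * x 2) ^ 2 ≤ A * P := by
          nlinarith [sq_nonneg (y 0 * x 1 - y 1 * x 0), sq_nonneg (y 0 * x 2 - y 2 * x 0),
            sq_nonneg (y 1 * x 2 - y 2 * x 1)]
        have hlt : (y 0 * x 0 + y 1 * x 1 + y 2 * x 2) ^ 2 < (y 3 * x 3) ^ 2 := by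
          have : A * P < (x 3 * x 3) * (y 3 * y 3) :=
            mul_lt_mul'' (by linarith) (by linarith) hA0 hP0
          nlinarith
        have := lt_of_pow_lt_pow_left₀ 2 (by positivity) hlt
        linarith
  have hv0 : y - p • x ≠ 0 := by
    intro h
    rw [h, form_zero_left, mul_zero, add_zero] at hp2
    have hyp : y = p • x := sub_eq_zero.1 h
    rcases sq_eq_one_iff.1 hp2 with h1 | h1
    · exact hxy (by rw [hyp, h1, one_smul])
    · rcases lt_or_ge 0 ρ with h2 | h2
      · exact hxy' h2 (by rw [hyp, h1]; module)
      · linarith [hp0 h2]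
  have hpos := form_self_pos hx hp1 hv0
  set q := √(form ρ (y - p • x) (y - p • x)) with hq
  have hq0 : 0 < q := Real.sqrt_pos.2 hpos
  have hqq : q ^ 2 = form ρ (y - p • x) (y - p • x) := Real.sq_sqrt hpos.le
  obtain ⟨s, hs1, hs2⟩ := exists_cosK_sinK (by rw [hqq]; exact hp2) hq0.le hp0
  refine ⟨q⁻¹ • (y - p • x), s, ⟨fun h => ?_, fun h => ?_⟩, ?_, ?_⟩
  · rw [Pi.smul_apply, hp1.1 h, smul_zero]
  · rw [form_smul_left, hp1.2 h, mul_zero]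
  · rw [form_smul_left, form_smul_right, ← hqq]; field_simp
  · rw [hs1, hs2, smul_smul, mul_inv_cancel₀ hq0.ne']; module

/-! ### The field `(⟨x, w⟩ + c) B - ⟨x, B⟩ w` and its flow -/

/-- Data of an infinitesimal rotation: a unit vector `B` orthogonal to `w`. The constant `c` is only
present in the Euclidean case, where it fixes the position of the axis. -/
structure IsRotationData (ρ : ℝ) (w B : V) (c : ℝ) : Prop where
  form_w_B : form ρ w B = 0
  form_B_B : form ρ B B = 1
  w_three : ρ = 0 → w 3 = 0
  B_three : ρ = 0 → B 3 = 0
  const : ρ ≠ 0 → c = 0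

/-- The infinitesimal rotation in the plane of `w` and `B`. -/
def rotField (ρ : ℝ) (w B : V) (c : ℝ) (x : V) : V := (form ρ x w + c) • B - form ρ x B • w

/-- The linear part of the flow of `rotField`. -/
def rotLin (ρ : ℝ) (w B : V) (t : ℝ) : V →ₗ[ℝ] V where
  toFun x := x + (sinK (form ρ w w) t * form ρ x w + (cosK (form ρ w w) t - 1) * form ρ x B) • B
    - (sinK (form ρ w w) t * form ρ x B + verK (form ρ w w) t * form ρ x w) • w
  map_add' x y := by
    simp only [form_add_left]; module
  map_smul' r x := by
    simp only [form_smul_left, RingHom.id_apply]; module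

/-- The flow of `rotField`. -/
def rotFlow (ρ : ℝ) (w B : V) (c t : ℝ) (x : V) : V :=
  rotLin ρ w B t x + c • (sinK (form ρ w w) t • B - verK (form ρ w w) t • w)

lemma rotLin_apply (ρ : ℝ) (w B : V) (t : ℝ) (x : V) : rotLin ρ w B t x =
    x + (sinK (form ρ w w) t * form ρ x w + (cosK (form ρ w w) t - 1) * form ρ x B) • B
    - (sinK (form ρ w w) t * form ρ x B + verK (form ρ w w) t * form ρ x w) • w := rfl

variable {w B : V} {c : ℝ}

lemma IsRotationData.form_B_w (h : IsRotationData ρ w B c) : form ρ B w = 0 := by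
  rw [form_comm, h.form_w_B]

lemma IsRotationData.form_rotLin (h : IsRotationData ρ w B c) (t : ℝ) (x y : V) :
    form ρ (rotLin ρ w B t x) (rotLin ρ w B t y) = form ρ x y := by
  have h1 : cosK (form ρ w w) t = 1 - form ρ w w * verK (form ρ w w) t := by
    rw [mul_verK]; ring
  have h2 := sinK_sq (form ρ w w) t
  rw [h1] at h2
  simp only [rotLin_apply, form_add_left, form_add_right, form_sub_left, form_sub_right,
    form_smul_left, form_smul_right, h.form_w_B, h.form_B_w, h.form_B_B, form_comm ρ w y,
    form_comm ρ B y]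
  rw [h1]
  linear_combination (form ρ x w * form ρ y w + form ρ w w * (form ρ x B * form ρ y B)) * h2

lemma IsRotationData.form_rotFlow_w (h : IsRotationData ρ w B c) (t : ℝ) (x : V) :
    form ρ (rotFlow ρ w B c t x) w + c =
      cosK (form ρ w w) t * (form ρ x w + c) - form ρ w w * sinK (form ρ w w) t * form ρ x B := by
  have h1 := mul_verK (form ρ w w) t
  simp only [rotFlow, rotLin_apply, form_add_left, form_sub_left, form_smul_left, h.form_B_w]
  linear_combination -(form ρ x w + c) * h1

lemma IsRotationData.form_rotFlow_B (h : IsRotationData ρ w B c) (t : ℝ) (x : V) :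
    form ρ (rotFlow ρ w B c t x) B =
      sinK (form ρ w w) t * (form ρ x w + c) + cosK (form ρ w w) t * form ρ x B := by
  simp only [rotFlow, rotLin_apply, form_add_left, form_sub_left, form_smul_left, h.form_w_B,
    h.form_B_B]
  ring

lemma IsRotationData.hasDerivAt_rotFlow (h : IsRotationData ρ w B c) (t : ℝ) (x : V) :
    HasDerivAt (fun r => rotFlow ρ w B c r x) (rotField ρ w B c (rotFlow ρ w B c t x)) t := by
  have hS := hasDerivAt_sinK (form ρ w w) t
  have hC := hasDerivAt_cosK (form ρ w w) t
  have hD := hasDerivAt_verK (form ρ w w) t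
  rw [rotField, h.form_rotFlow_w, h.form_rotFlow_B]
  refine ((((((hS.mul_const (form ρ x w)).add ((hC.sub_const 1).mul_const (form ρ x B))).smul_const
    B).const_add x).sub (((hS.mul_const (form ρ x B)).add (hD.mul_const (form ρ x w))).smul_const
    w)).add (((hS.smul_const B).sub (hD.smul_const w)).const_smul c)).congr_deriv ?_
  module

lemma rotFlow_zero (ρ : ℝ) (w B : V) (c : ℝ) (x : V) : rotFlow ρ w B c 0 x = x := by
  simp [rotFlow, rotLin_apply, sinK_zero, cosK_zero, verK_zero]

lemma contDiff_rotFlow (ρ : ℝ) (w B : V) (c t : ℝ) : ContDiff ℝ ∞ (rotFlow ρ w B c t) :=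
  (LinearMap.toContinuousLinearMap (rotLin ρ w B t)).contDiff.add contDiff_const

lemma hasDerivAt_rotFlow_comp {γ : ℝ → V} {v : V} {s : ℝ} (hγ : HasDerivAt γ v s) (t : ℝ) :
    HasDerivAt (fun r => rotFlow ρ w B c t (γ r)) (rotLin ρ w B t v) s :=
  ((LinearMap.toContinuousLinearMap (rotLin ρ w B t)).hasFDerivAt.comp_hasDerivAt s hγ).add_const _

lemma IsRotationData.rotFlow_mem (h : IsRotationData ρ w B c) (t : ℝ) {x : V} (hx : x ∈ M3 ρ) :
    rotFlow ρ w B c t x ∈ M3 ρ := by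
  have key : ρ ≠ 0 → ∀ t, form ρ (rotFlow ρ w B c t x) (rotFlow ρ w B c t x) = 1 / ρ := by
    intro h0 t
    rw [← hx.2.1 h0, rotFlow, h.const h0, zero_smul, add_zero, h.form_rotLin]
  refine ⟨fun h0 => ?_, fun h0 => key h0 t, fun h0 => ?_⟩
  · simp [rotFlow, rotLin_apply, h.w_three h0, h.B_three h0, hx.1 h0]
  · refine pos_of_path (c := fun t => rotFlow ρ w B c t x) h0 ?_ (key h0.ne) ?_ t
    · exact continuous_iff_continuousAt.2 fun t => (h.hasDerivAt_rotFlow t x).continuousAt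
    · simpa [rotFlow_zero] using hx.2.2 h0

/-- Integral curves of `rotField` are given by `rotFlow`. -/
lemma IsRotationData.eq_rotFlow (h : IsRotationData ρ w B c) {g : ℝ → V}
    (hg : ∀ t, HasDerivAt g (rotField ρ w B c (g t)) t) (t : ℝ) :
    g t = rotFlow ρ w B c t (g 0) := by
  let A : V →ₗ[ℝ] V :=
    { toFun := fun x => form ρ x w • B - form ρ x B • w
      map_add' := fun x y => by simp only [form_add_left]; module
      map_smul' := fun r x => by simp only [form_smul_left, RingHom.id_apply]; module }
  have hA : ∀ x y, rotField ρ w B c x - rotField ρ w B c y = A x - A y := by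
    intro x y
    change _ = (form ρ x w • B - form ρ x B • w) - (form ρ y w • B - form ρ y B • w)
    simp only [rotField]
    module
  have hL : LipschitzWith ‖LinearMap.toContinuousLinearMap A‖₊ (rotField ρ w B c) := by
    refine LipschitzWith.of_dist_le_mul fun x y => ?_
    rw [dist_eq_norm, hA, ← dist_eq_norm]
    exact (LinearMap.toContinuousLinearMap A).lipschitz.dist_le_mul x y
  have := ODE_solution_unique_univ (v := fun _ => rotField ρ w B c) (s := fun _ => Set.univ)
    (t₀ := 0) (fun _ => hL.lipschitzOnWith) (fun t => ⟨hg t, trivial⟩)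
    (fun t => ⟨h.hasDerivAt_rotFlow t (g 0), trivial⟩) (by rw [rotFlow_zero])
  exact congrFun this t

lemma IsRotationData.rotFlow_add (h : IsRotationData ρ w B c) (s t : ℝ) (x : V) :
    rotFlow ρ w B c (s + t) x = rotFlow ρ w B c s (rotFlow ρ w B c t x) := by
  have := h.eq_rotFlow (g := fun r => rotFlow ρ w B c (r + t) x)
    (fun r => (h.hasDerivAt_rotFlow (r + t) x).comp_add_const r t) s
  simpa using this

lemma IsRotationData.isKillingField (h : IsRotationData ρ w B c) :
    IsKillingField ρ (rotField ρ w B c) := by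
  refine ⟨?_, fun x hx => ⟨fun h0 => ?_, fun h0 => ?_⟩, fun γ hγ hm s => ?_⟩
  · exact (((contDiffOn_id.form ρ contDiffOn_const).add contDiffOn_const).smul
      contDiffOn_const).sub ((contDiffOn_id.form ρ contDiffOn_const).smul contDiffOn_const)
  · simp [rotField, h.w_three h0, h.B_three h0]
  · simp only [rotField, h.const h0, form_sub_left, form_smul_left, form_comm ρ B x,
      form_comm ρ w x]
    ring
  · have hd := (hγ.differentiable (by simp) s).hasDerivAt
    have hK : HasDerivAt (fun r => rotField ρ w B c (γ r))
        (form ρ (deriv γ s) w • B - form ρ (deriv γ s) B • w) s := by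
      have h1 := hd.form ρ (hasDerivAt_const s w)
      have h2 := hd.form ρ (hasDerivAt_const s B)
      rw [form_zero_right, add_zero] at h1 h2
      exact ((h1.add_const c).smul_const B).sub (h2.smul_const w)
    have h3 : ρ * form ρ (γ s) (deriv γ s) = 0 := by
      rcases eq_or_ne ρ 0 with h0 | h0
      · rw [h0, zero_mul]
      · have h4 := hd.form ρ hd
        have h5 : (fun r => form ρ (γ r) (γ r)) = fun _ => 1 / ρ := funext fun r => (hm r).2.1 h0
        rw [h5] at h4
        have h6 := h4.unique (hasDerivAt_const s _)
        rw [form_comm ρ (deriv γ s)] at h6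
        linear_combination ρ / 2 * h6
    rw [covDeriv, hK.deriv, tangProj]
    simp only [form_sub_left, form_smul_left, form_comm ρ B, form_comm ρ w]
    linear_combination -(form ρ (deriv γ s) w * form ρ (γ s) B -
      form ρ (deriv γ s) B * form ρ (γ s) w) * h3

lemma IsRotationData.isFlow (h : IsRotationData ρ w B c) :
    IsFlow ρ (rotField ρ w B c) (rotFlow ρ w B c) :=
  ⟨fun x _ => rotFlow_zero ρ w B c x, fun t _ hx => h.rotFlow_mem t hx,
    fun t x _ => h.hasDerivAt_rotFlow t x⟩

lemma IsRotationData.eq_rotFlow_of_isFlow (h : IsRotationData ρ w B c) {ξ : V → V}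
    {φ : ℝ → V → V} (hξ : ∀ x ∈ M3 ρ, ξ x = rotField ρ w B c x) (hφ : IsFlow ρ ξ φ) (t : ℝ) {x : V}
    (hx : x ∈ M3 ρ) : φ t x = rotFlow ρ w B c t x := by
  have := h.eq_rotFlow (g := fun r => φ r x) (fun r => by
    rw [← hξ _ (hφ.mem r x hx)]; exact hφ.hasDerivAt r x hx) t
  simpa only [hφ.zero x hx] using this

lemma IsRotationData.isOneParamIsometryGroup (h : IsRotationData ρ w B c) {φ : ℝ → V → V}
    (hφ : ∀ t, ∀ x ∈ M3 ρ, φ t x = rotFlow ρ w B c t x) : IsOneParamIsometryGroup ρ φ := by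
  have hm : ∀ t, ∀ x ∈ M3 ρ, φ t x ∈ M3 ρ := fun t x hx => by
    rw [hφ t x hx]; exact h.rotFlow_mem t hx
  refine ⟨hm, fun x hx => ?_, fun s t x hx => ?_, fun x hx => ?_, fun t => ?_,
    fun t γ hγ hmem s => ?_⟩
  · rw [hφ 0 x hx, rotFlow_zero]
  · rw [hφ _ x hx, hφ _ _ (hm t x hx), hφ t x hx, h.rotFlow_add]
  · simp only [hφ _ x hx]
    exact continuous_iff_continuousAt.2 fun t => (h.hasDerivAt_rotFlow t x).continuousAt
  · exact (contDiff_rotFlow ρ w B c t).contDiffOn.congr (hφ t)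
  · have e : (fun r => φ t (γ r)) = fun r => rotFlow ρ w B c t (γ r) :=
      funext fun r => hφ t _ (hmem r)
    rw [e, (hasDerivAt_rotFlow_comp (hγ.differentiable (by simp) s).hasDerivAt t).deriv,
      h.form_rotLin]

/-- The points where `rotField` vanishes are fixed by the flow. -/
lemma rotFlow_eq_self {x : V} (h1 : form ρ x w + c = 0) (h2 : form ρ x B = 0) (t : ℝ) :
    rotFlow ρ w B c t x = x := by
  have h3 : form ρ x w = -c := by linarith
  rw [rotFlow, rotLin_apply, h2, h3]
  module

/-! ### Uniqueness of Killing fields -/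

lemma IsKillingField.form_velocity_eq {ξ : V → V} (hξ : IsKillingField ρ ξ) {x e : V}
    (hx : x ∈ M3 ρ) (he : IsTangent ρ x e) (h1 : form ρ e e = 1) (s : ℝ) :
    form ρ (ξ (cosK ρ s • x + sinK ρ s • e)) ((-ρ * sinK ρ s) • x + cosK ρ s • e) =
      form ρ (ξ x) e := by
  set g : ℝ → V := fun s => cosK ρ s • x + sinK ρ s • e with hg
  have hgd : ∀ s, HasDerivAt g ((-ρ * sinK ρ s) • x + cosK ρ s • e) s :=
    hasDerivAt_geodesicCurve ρ x e
  have hgm : ∀ s, g s ∈ M3 ρ := geodesicCurve_mem hx he h1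
  have hgc : ContDiff ℝ ∞ g := contDiff_geodesicCurve ρ x e
  have hξg : ContDiff ℝ ∞ fun r => ξ (g r) := hξ.smooth.comp_contDiff hgc hgm
  have hd : ∀ s, HasDerivAt
      (fun s => form ρ (ξ (g s)) ((-ρ * sinK ρ s) • x + cosK ρ s • e)) 0 s := by
    intro s
    have h2 := (hξg.differentiable (by simp) s).hasDerivAt
    have h3 : HasDerivAt (fun s => (-ρ * sinK ρ s) • x + cosK ρ s • e) ((-ρ) • g s) s :=
      ((((hasDerivAt_sinK ρ s).const_mul (-ρ)).smul_const x).add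
        ((hasDerivAt_cosK ρ s).smul_const e)).congr_deriv (by simp only [hg]; module)
    refine (h2.form ρ h3).congr_deriv ?_
    have h4 := hξ.killing g hgc hgm s
    rw [(hgd s).deriv, covDeriv, tangProj, form_sub_left, form_smul_left] at h4
    rw [form_smul_right]
    rcases eq_or_ne ρ 0 with h0 | h0
    · rw [h0] at h4 ⊢
      linear_combination h4
    · have h5 := (hξ.tangent _ (hgm s)).2 h0
      have h6 : form ρ (g s) ((-ρ * sinK ρ s) • x + cosK ρ s • e) = 0 := by
        have h7 := he.2 h0
        have h8 := form_self_of_mem h0 hx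
        simp only [hg, form_add_left, form_add_right, form_smul_left, form_smul_right, h7, h1,
          form_comm ρ x e]
        linear_combination -(cosK ρ s * sinK ρ s) * h8
      rw [h6] at h4
      rw [h5]
      linear_combination h4
  have := is_const_of_deriv_eq_zero (fun s => (hd s).differentiableAt) (fun s => (hd s).deriv) s 0
  simpa [hg, cosK_zero, sinK_zero] using this

/-- Since `⟨ξ, c'⟩` is constant along geodesics `c`, the values of a Killing field at two points are
linked by a linear equation. -/
lemma IsKillingField.form_add_form_eq_zero {ξ : V → V} (hξ : IsKillingField ρ ξ) {x y : V}
    (hx : x ∈ M3 ρ) (hy : y ∈ M3 ρ) : form ρ (ξ x) (y - x) + form ρ (ξ y) (x - y) = 0 := by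
  by_cases hxy : y = x
  · simp [hxy, form_zero_right]
  by_cases hxy' : 0 < ρ ∧ y = -x
  · have h1 := (hξ.tangent x hx).2 hxy'.1.ne'
    have h2 := (hξ.tangent y hy).2 hxy'.1.ne'
    rw [show y - x = (-2 : ℝ) • x by rw [hxy'.2]; module,
      show x - y = (-2 : ℝ) • y by rw [hxy'.2]; module, form_smul_right, form_smul_right, h1, h2]
    ring
  obtain ⟨e, s, he, h1, rfl⟩ := exists_geodesicCurve_through hx hy hxy fun h h' => hxy' ⟨h, h'⟩
  have h2 := hξ.form_velocity_eq hx he h1 s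
  have h3 := cosK_sq_add ρ s
  set y := cosK ρ s • x + sinK ρ s • e with hy'
  set y' := (-ρ * sinK ρ s) • x + cosK ρ s • e with hy''
  have hx' : x = cosK ρ s • y - sinK ρ s • y' := by
    calc x = (cosK ρ s ^ 2 + ρ * sinK ρ s ^ 2) • x := by rw [h3, one_smul]
      _ = _ := by rw [hy', hy'']; module
  have hC : (cosK ρ s - 1) * form ρ (ξ x) x = 0 ∧ (cosK ρ s - 1) * form ρ (ξ y) y = 0 := by
    rcases eq_or_ne ρ 0 with rfl | h0
    · simp [cosK]
    · rw [(hξ.tangent x hx).2 h0, (hξ.tangent y hy).2 h0]; simp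
  have e1 : form ρ (ξ x) (y - x) = (cosK ρ s - 1) * form ρ (ξ x) x + sinK ρ s * form ρ (ξ x) e := by
    rw [hy']; simp only [form_sub_right, form_add_right, form_smul_right]; ring
  have e2 : form ρ (ξ y) (x - y) =
      (cosK ρ s - 1) * form ρ (ξ y) y - sinK ρ s * form ρ (ξ y) y' := by
    rw [form_sub_right]
    nth_rewrite 1 [hx']
    simp only [form_sub_right, form_smul_right]; ring
  rw [e1, e2, hC.1, hC.2, h2]
  ring

/-- A vector orthogonal to a frame of the slice `x 0 = 0` is a multiple of the first basis vector. -/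
lemma eq_smul_of_orthogonal {x T N u : V} (hx : x ∈ M2 ρ) (hT : IsTangent ρ x T)
    (hT0 : T 0 = 0) (hN : IsTangent ρ x N) (hN0 : N 0 = 0) (hTT : form ρ T T = 1)
    (hNN : form ρ N N = 1) (hNT : form ρ N T = 0) (hu3 : ρ = 0 → u 3 = 0)
    (hux : ρ ≠ 0 → form ρ u x = 0) (huT : form ρ u T = 0) (huN : form ρ u N = 0) :
    u = u 0 • Pi.single 0 1 := by
  suffices h : u 1 = 0 ∧ u 2 = 0 ∧ u 3 = 0 by
    funext i
    fin_cases i <;> simp [h.1, h.2.1, h.2.2]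
  rcases eq_or_ne ρ 0 with h0 | h0
  · have hσ : Real.sign ρ = 0 := by rw [h0, Real.sign_zero]
    simp only [form, hT0, hN0, hσ] at hTT hNN hNT huT huN
    -- the Gram determinant
    have hd : (T 1 * N 2 - T 2 * N 1) ^ 2 = 1 := by
      linear_combination (N 1 * N 1 + N 2 * N 2) * hTT + hNN - (N 1 * T 1 + N 2 * T 2) * hNT
    have hd0 : T 1 * N 2 - T 2 * N 1 ≠ 0 := by
      intro h; rw [h] at hd; norm_num at hd
    refine ⟨mul_left_cancel₀ hd0 ?_, mul_left_cancel₀ hd0 ?_, hu3 h0⟩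
    · linear_combination N 2 * huT - T 2 * huN
    · linear_combination T 1 * huN - N 1 * huT
  · have hxx := form_self_of_mem h0 hx.1
    have hTx := hT.2 h0
    have hNx := hN.2 h0
    have hux := hux h0
    have hσ : Real.sign ρ ≠ 0 := by rw [Ne, Real.sign_eq_zero_iff]; exact h0
    simp only [form, hT0, hN0, hx.2] at hTT hNN hNT huT huN hTx hNx hux hxx
    set σ := Real.sign ρ
    set d := x 1 * (T 2 * N 3 - T 3 * N 2) - x 2 * (T 1 * N 3 - T 3 * N 1) +
      x 3 * (T 1 * N 2 - T 2 * N 1) with hd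
    -- the Gram determinant
    have hdet : ρ * (σ * d ^ 2) = 1 := by
      have e : σ * d ^ 2 =
        (x 1 * x 1 + x 2 * x 2 + σ * (x 3 * x 3)) *
          ((T 1 * T 1 + T 2 * T 2 + σ * (T 3 * T 3)) * (N 1 * N 1 + N 2 * N 2 + σ * (N 3 * N 3)) -
            (N 1 * T 1 + N 2 * T 2 + σ * (N 3 * T 3)) ^ 2) -
        (T 1 * x 1 + T 2 * x 2 + σ * (T 3 * x 3)) *
          ((T 1 * x 1 + T 2 * x 2 + σ * (T 3 * x 3)) * (N 1 * N 1 + N 2 * N 2 + σ * (N 3 * N 3)) -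
            (N 1 * T 1 + N 2 * T 2 + σ * (N 3 * T 3)) *
              (N 1 * x 1 + N 2 * x 2 + σ * (N 3 * x 3))) +
        (N 1 * x 1 + N 2 * x 2 + σ * (N 3 * x 3)) *
          ((T 1 * x 1 + T 2 * x 2 + σ * (T 3 * x 3)) * (N 1 * T 1 + N 2 * T 2 + σ * (N 3 * T 3)) -
            (T 1 * T 1 + T 2 * T 2 + σ * (T 3 * T 3)) *
              (N 1 * x 1 + N 2 * x 2 + σ * (N 3 * x 3))) := by
        rw [hd]; ring
      have f1 : T 1 * x 1 + T 2 * x 2 + σ * (T 3 * x 3) = 0 := by linear_combination hTx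
      have f2 : N 1 * x 1 + N 2 * x 2 + σ * (N 3 * x 3) = 0 := by linear_combination hNx
      have f3 : N 1 * T 1 + N 2 * T 2 + σ * (N 3 * T 3) = 0 := by linear_combination hNT
      have f4 : T 1 * T 1 + T 2 * T 2 + σ * (T 3 * T 3) = 1 := by linear_combination hTT
      have f5 : N 1 * N 1 + N 2 * N 2 + σ * (N 3 * N 3) = 1 := by linear_combination hNN
      rw [e, f1, f2, f3, f4, f5]
      linear_combination hxx
    have hd0 : d ≠ 0 := by
      intro h; rw [h] at hdet; norm_num at hdet
    refine ⟨mul_left_cancel₀ hd0 ?_, mul_left_cancel₀ hd0 ?_,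
      mul_left_cancel₀ (mul_ne_zero hσ hd0) ?_⟩
    · rw [hd]
      linear_combination (T 2 * N 3 - T 3 * N 2) * hux + (N 2 * x 3 - N 3 * x 2) * huT +
        (x 2 * T 3 - x 3 * T 2) * huN
    · rw [hd]
      linear_combination (T 3 * N 1 - T 1 * N 3) * hux + (N 3 * x 1 - N 1 * x 3) * huT +
        (x 3 * T 1 - x 1 * T 3) * huN
    · rw [hd]
      linear_combination (T 1 * N 2 - T 2 * N 1) * hux + (N 1 * x 2 - N 2 * x 1) * huT +
        (x 1 * T 2 - x 2 * T 1) * huN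

/-! ### Frenet equations in the ambient space -/

lemma eq_zero_of_hasDerivAt_of_forall_eq {I : Set ℝ} (hI : IsOpen I) {s : ℝ} (hs : s ∈ I)
    {u : ℝ → ℝ} {u' k : ℝ} (h : HasDerivAt u u' s) (hk : ∀ r ∈ I, u r = k) : u' = 0 :=
  h.unique ((hasDerivAt_const s k).congr_of_eventuallyEq
    (Filter.eventually_of_mem (hI.mem_nhds hs) hk))

lemma hasDerivAt_of_contDiffOn {E : Type*} [NormedAddCommGroup E] [NormedSpace ℝ E] {I : Set ℝ}
    (hI : IsOpen I) {u : ℝ → E} (hu : ContDiffOn ℝ ∞ u I) {s : ℝ} (hs : s ∈ I) :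
    HasDerivAt u (deriv u s) s :=
  ((hu.differentiableOn (by simp)).differentiableAt (hI.mem_nhds hs)).hasDerivAt

variable {I : Set ℝ} {γ N B : ℝ → V} {κ : ℝ → ℝ}

namespace IsPlanarFrenetCurve

lemma hasDerivAt_curve (hγ : IsPlanarFrenetCurve ρ I γ N B κ) (hI : IsOpen I) {s : ℝ}
    (hs : s ∈ I) : HasDerivAt γ (deriv γ s) s :=
  hasDerivAt_of_contDiffOn hI hγ.smooth_curve hs

lemma isTangent_velocity (hγ : IsPlanarFrenetCurve ρ I γ N B κ) (hI : IsOpen I) {s : ℝ}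
    (hs : s ∈ I) : IsTangent ρ (γ s) (deriv γ s) := by
  have hd := hγ.hasDerivAt_curve hI hs
  refine ⟨fun h0 => ?_, fun h0 => ?_⟩
  · exact eq_zero_of_hasDerivAt_of_forall_eq hI hs (hasDerivAt_pi.1 hd 3)
      fun r hr => (hγ.mem r hr).1.1 h0
  · have := eq_zero_of_hasDerivAt_of_forall_eq hI hs (hd.form ρ hd)
      fun r hr => (hγ.mem r hr).1.2.1 h0
    rw [form_comm ρ (γ s)] at this
    linarith

lemma velocity_zero (hγ : IsPlanarFrenetCurve ρ I γ N B κ) (hI : IsOpen I) {s : ℝ}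
    (hs : s ∈ I) : deriv γ s 0 = 0 :=
  eq_zero_of_hasDerivAt_of_forall_eq hI hs (hasDerivAt_pi.1 (hγ.hasDerivAt_curve hI hs) 0)
    fun r hr => (hγ.mem r hr).2

/-- Gauss formula: the ambient derivative of a field `W` along `γ` that is tangent to the space form
differs from the covariant one by a multiple of the normal direction `γ`. -/
lemma deriv_eq_covDeriv_sub (hγ : IsPlanarFrenetCurve ρ I γ N B κ) (hI : IsOpen I) {W : ℝ → V}
    {W' : V} {s : ℝ} (hs : s ∈ I) (hW : HasDerivAt W W' s)
    (ht : ∀ r ∈ I, ρ ≠ 0 → form ρ (W r) (γ r) = 0) :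
    W' = covDeriv ρ γ W s - (ρ * form ρ (W s) (deriv γ s)) • γ s := by
  have h : ρ * form ρ W' (γ s) = -(ρ * form ρ (W s) (deriv γ s)) := by
    rcases eq_or_ne ρ 0 with h0 | h0
    · rw [h0]; ring
    · have := eq_zero_of_hasDerivAt_of_forall_eq hI hs
        (hW.form ρ (hγ.hasDerivAt_curve hI hs)) fun r hr => ht r hr h0
      linear_combination ρ * this
  rw [covDeriv, tangProj, hW.deriv, h]
  module

lemma hasDerivAt_velocity (hγ : IsPlanarFrenetCurve ρ I γ N B κ) (hI : IsOpen I) {s : ℝ}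
    (hs : s ∈ I) : HasDerivAt (deriv γ) (κ s • N s - ρ • γ s) s := by
  have hd := hasDerivAt_of_contDiffOn hI (hγ.smooth_curve.deriv_of_isOpen hI (by simp)) hs
  have := hγ.deriv_eq_covDeriv_sub hI hs hd fun r hr => (hγ.isTangent_velocity hI hr).2
  rw [hγ.frenet_tangent s hs, hγ.unit_speed s hs, mul_one] at this
  rwa [this] at hd

lemma hasDerivAt_normal (hγ : IsPlanarFrenetCurve ρ I γ N B κ) (hI : IsOpen I) {s : ℝ}
    (hs : s ∈ I) : HasDerivAt N (-κ s • deriv γ s) s := by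
  have hd := hasDerivAt_of_contDiffOn hI hγ.smooth_normal hs
  have := hγ.deriv_eq_covDeriv_sub hI hs hd fun r hr => (hγ.normal_tangent r hr).1.2
  rw [hγ.frenet_normal s hs, hγ.normal_orthogonal s hs, mul_zero, zero_smul, sub_zero] at this
  rwa [this] at hd

lemma hasDerivAt_binormal (hγ : IsPlanarFrenetCurve ρ I γ N B κ) (hI : IsOpen I) {s : ℝ}
    (hs : s ∈ I) : HasDerivAt B 0 s := by
  have hd := hasDerivAt_of_contDiffOn hI hγ.smooth_binormal hs
  have := hγ.deriv_eq_covDeriv_sub hI hs hd fun r hr => (hγ.binormal_tangent r hr).2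
  rw [hγ.frenet_binormal s hs, (hγ.binormal_orthogonal s hs).1, mul_zero, zero_smul,
    sub_zero] at this
  rwa [this] at hd

/-- A vector orthogonal to the frame of the slice `x 0 = 0` formed by the curve, its velocity and
its normal is a multiple of the first basis vector. -/
lemma eq_smul_single (hγ : IsPlanarFrenetCurve ρ I γ N B κ) (hI : IsOpen I) {s : ℝ}
    (hs : s ∈ I) {u : V} (hu : IsTangent ρ (γ s) u) (huT : form ρ u (deriv γ s) = 0)
    (huN : form ρ u (N s) = 0) : u = u 0 • Pi.single 0 1 :=
  eq_smul_of_orthogonal (hγ.mem s hs) (hγ.isTangent_velocity hI hs) (hγ.velocity_zero hI hs)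
    (hγ.normal_tangent s hs).1 (hγ.normal_tangent s hs).2 (hγ.unit_speed s hs)
    (hγ.normal_unit s hs) (hγ.normal_orthogonal s hs) hu.1 hu.2 huT huN

lemma binormal_eq_smul_single (hγ : IsPlanarFrenetCurve ρ I γ N B κ) (hI : IsOpen I) {s : ℝ}
    (hs : s ∈ I) : B s = B s 0 • Pi.single 0 1 :=
  hγ.eq_smul_single hI hs (hγ.binormal_tangent s hs) (hγ.binormal_orthogonal s hs).1
    (hγ.binormal_orthogonal s hs).2

/-- A Killing field is determined by its values along the curve. -/
lemma killing_eqOn (hγ : IsPlanarFrenetCurve ρ I γ N B κ) (hI : IsOpen I) (hne : I.Nonempty)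
    {ξ ζ : V → V} (hξ : IsKillingField ρ ξ) (hζ : IsKillingField ρ ζ)
    (h : ∀ s ∈ I, ξ (γ s) = ζ (γ s)) : ∀ x ∈ M3 ρ, ξ x = ζ x := by
  obtain ⟨s, hs⟩ := hne
  have hpair : ∀ x ∈ M3 ρ, ∀ y ∈ M3 ρ,
      form ρ (ξ x - ζ x) (y - x) + form ρ (ξ y - ζ y) (x - y) = 0 := by
    intro x hx y hy
    rw [form_sub_left, form_sub_left]
    linear_combination hξ.form_add_form_eq_zero hx hy - hζ.form_add_form_eq_zero hx hy
  have htan : ∀ x ∈ M3 ρ, IsTangent ρ x (ξ x - ζ x) := fun x hx =>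
    ⟨fun h0 => by simp [(hξ.tangent x hx).1 h0, (hζ.tangent x hx).1 h0], fun h0 => by
      rw [form_sub_left, (hξ.tangent x hx).2 h0, (hζ.tangent x hx).2 h0, sub_zero]⟩
  -- the difference takes values in the direction orthogonal to the slice containing the curve
  have hdir : ∀ x ∈ M3 ρ, ξ x - ζ x = (ξ x - ζ x) 0 • Pi.single 0 1 := by
    intro x hx
    have h0 : ∀ r ∈ I, form ρ (ξ x - ζ x) (γ r) = form ρ (ξ x - ζ x) x := by
      intro r hr
      have := hpair x hx (γ r) (hγ.mem r hr).1
      rw [h r hr, sub_self, form_zero_left, add_zero, form_sub_right] at this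
      linarith
    have h1 : ∀ r ∈ I, form ρ (ξ x - ζ x) (deriv γ r) = 0 := by
      intro r hr
      have := (hasDerivAt_const r (ξ x - ζ x)).form ρ (hγ.hasDerivAt_curve hI hr)
      rw [form_zero_left, zero_add] at this
      exact eq_zero_of_hasDerivAt_of_forall_eq hI hr this h0
    have h2 : ρ ≠ 0 → form ρ (ξ x - ζ x) (γ s) = 0 := fun hρ => by
      rw [h0 s hs, (htan x hx).2 hρ]
    refine hγ.eq_smul_single hI hs ⟨(htan x hx).1, h2⟩ (h1 s hs) ?_
    have h3 := (hasDerivAt_const s (ξ x - ζ x)).form ρ (hγ.hasDerivAt_velocity hI hs)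
    rw [form_zero_left, zero_add] at h3
    have h4 := eq_zero_of_hasDerivAt_of_forall_eq hI hs h3 h1
    rw [form_sub_right, form_smul_right, form_smul_right] at h4
    have h5 : ρ * form ρ (ξ x - ζ x) (γ s) = 0 := by
      rcases eq_or_ne ρ 0 with hρ | hρ
      · rw [hρ, zero_mul]
      · rw [h2 hρ, mul_zero]
    rw [h5, sub_zero] at h4
    exact (mul_eq_zero.1 h4).resolve_left (hγ.curvature_ne_zero s hs)
  have hform : ∀ (l : ℝ) (v : V), form ρ (l • Pi.single 0 1) v = l * v 0 := by
    intro l v; simp [form]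
  have hzero : ∀ x ∈ M3 ρ, x 0 ≠ 0 → ξ x - ζ x = 0 := by
    intro x hx hx0
    have h1 := hpair x hx (γ s) (hγ.mem s hs).1
    rw [h s hs, sub_self, form_zero_left, add_zero, hdir x hx, hform, Pi.sub_apply (γ s),
      (hγ.mem s hs).2, zero_sub] at h1
    have h2 : (ξ x - ζ x) 0 = 0 := (mul_eq_zero.1 h1).resolve_right (neg_ne_zero.2 hx0)
    rw [hdir x hx, h2, zero_smul]
  intro x hx
  by_cases hx0 : x 0 = 0
  · -- a point off the slice
    have he : IsTangent ρ (γ s) (Pi.single 0 1) := by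
      refine ⟨fun _ => by simp, fun _ => ?_⟩
      simp [form, (hγ.mem s hs).2]
    obtain ⟨y, hy, hy0⟩ : ∃ y ∈ M3 ρ, y 0 ≠ 0 := by
      obtain ⟨t, ht⟩ : ∃ t, sinK ρ t ≠ 0 := by
        by_contra! h0
        have h1 := hasDerivAt_sinK ρ 0
        rw [show sinK ρ = fun _ => 0 from funext h0, cosK_zero] at h1
        exact one_ne_zero (h1.unique (hasDerivAt_const _ _))
      refine ⟨_, geodesicCurve_mem (hγ.mem s hs).1 he (by simp [form]) t, ?_⟩
      simpa [(hγ.mem s hs).2] using ht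
    have h1 := hpair x hx y hy
    rw [hzero y hy hy0, form_zero_left, add_zero, hdir x hx, hform, Pi.sub_apply y, hx0,
      sub_zero] at h1
    have h2 : (ξ x - ζ x) 0 = 0 := (mul_eq_zero.1 h1).resolve_right hy0
    rw [← sub_eq_zero, hdir x hx, h2, zero_smul]
  · exact sub_eq_zero.1 (hzero x hx hx0)

end IsPlanarFrenetCurve

variable {μ : ℝ}

/-! ### Conserved quantities of critical curves -/

/-- The function `μ exp (μ / κ)`. -/
def expFactor (μ : ℝ) (κ : ℝ → ℝ) (s : ℝ) : ℝ := μ * Real.exp (μ / κ s)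

/-- The vector `ρ f γ + f' T + h N` with `f = speedFactor μ κ` and `h = expFactor μ κ`, which is
constant along critical curves. -/
def conservedVector (ρ μ : ℝ) (γ N : ℝ → V) (κ : ℝ → ℝ) (s : ℝ) : V :=
  (ρ * speedFactor μ κ s) • γ s + deriv (speedFactor μ κ) s • deriv γ s + expFactor μ κ s • N s

lemma eqOn_const_of_hasDerivAt {E : Type*} [NormedAddCommGroup E] [NormedSpace ℝ E]
    (hI : IsOpen I) (hIc : I.OrdConnected) {u : ℝ → E} (hu : ∀ s ∈ I, HasDerivAt u 0 s) {r s : ℝ}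
    (hr : r ∈ I) (hs : s ∈ I) : u r = u s :=
  hI.is_const_of_deriv_eq_zero hIc.isPreconnected
    (fun x hx => (hu x hx).differentiableAt.differentiableWithinAt) (fun x hx => (hu x hx).deriv)
    hr hs

namespace IsPlanarFrenetCurve

lemma contDiffOn_quotient (hγ : IsPlanarFrenetCurve ρ I γ N B κ) :
    ContDiffOn ℝ ∞ (fun s => μ / κ s) I :=
  contDiffOn_const.div hγ.smooth_curvature hγ.curvature_ne_zero

lemma contDiffOn_speedFactor (hγ : IsPlanarFrenetCurve ρ I γ N B κ) :
    ContDiffOn ℝ ∞ (speedFactor μ κ) I :=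
  (contDiffOn_const.sub hγ.contDiffOn_quotient).mul hγ.contDiffOn_quotient.exp

lemma contDiffOn_expFactor (hγ : IsPlanarFrenetCurve ρ I γ N B κ) :
    ContDiffOn ℝ ∞ (expFactor μ κ) I :=
  contDiffOn_const.mul hγ.contDiffOn_quotient.exp

lemma deriv_speedFactor (hγ : IsPlanarFrenetCurve ρ I γ N B κ) (hI : IsOpen I) {s : ℝ}
    (hs : s ∈ I) : deriv (speedFactor μ κ) s =
      -(μ / κ s * deriv (fun r => μ / κ r) s * Real.exp (μ / κ s)) := by
  have hb := hasDerivAt_of_contDiffOn hI (hγ.contDiffOn_quotient (μ := μ)) hs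
  refine ((hb.const_sub 1).mul hb.exp).deriv.trans ?_
  ring

lemma hasDerivAt_speedFactor (hγ : IsPlanarFrenetCurve ρ I γ N B κ) (hI : IsOpen I) {s : ℝ}
    (hs : s ∈ I) : HasDerivAt (speedFactor μ κ) (deriv (speedFactor μ κ) s) s :=
  hasDerivAt_of_contDiffOn hI hγ.contDiffOn_speedFactor hs

lemma hasDerivAt_expFactor (hγ : IsPlanarFrenetCurve ρ I γ N B κ) (hI : IsOpen I) {s : ℝ}
    (hs : s ∈ I) : HasDerivAt (expFactor μ κ) (-(κ s * deriv (speedFactor μ κ) s)) s := by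
  have hb := hasDerivAt_of_contDiffOn hI (hγ.contDiffOn_quotient (μ := μ)) hs
  have hk := hγ.curvature_ne_zero s hs
  refine (hb.exp.const_mul μ).congr_deriv ?_
  rw [hγ.deriv_speedFactor hI hs]
  field_simp

lemma fieldJ_eq (hγ : IsPlanarFrenetCurve ρ I γ N B κ) (hI : IsOpen I) {s : ℝ} (hs : s ∈ I) :
    fieldJ ρ μ γ N κ s = deriv (speedFactor μ κ) s • N s - expFactor μ κ s • deriv γ s := by
  have hk := hγ.curvature_ne_zero s hs
  have hK : HasDerivAt (fieldK μ N κ) _ s :=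
    (hγ.hasDerivAt_speedFactor (μ := μ) hI hs).smul (hγ.hasDerivAt_normal hI hs)
  have ht : IsTangent ρ (γ s) (speedFactor μ κ s • (-κ s • deriv γ s) +
      deriv (speedFactor μ κ) s • N s) := by
    have h1 := hγ.isTangent_velocity hI hs
    have h2 := (hγ.normal_tangent s hs).1
    refine ⟨fun h0 => ?_, fun h0 => ?_⟩
    · simp [h1.1 h0, h2.1 h0]
    · simp [form_add_left, form_neg_left, form_smul_left, h1.2 h0, h2.2 h0]
  rw [fieldJ, covDeriv, hK.deriv, tangProj_of_isTangent ht]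
  have e : (κ s - 2 * μ) * Real.exp (μ / κ s) - speedFactor μ κ s * κ s = -expFactor μ κ s := by
    rw [speedFactor, expFactor]; field_simp; ring
  calc _ = deriv (speedFactor μ κ) s • N s +
      ((κ s - 2 * μ) * Real.exp (μ / κ s) - speedFactor μ κ s * κ s) • deriv γ s := by module
    _ = _ := by rw [e]; module

/-- The Euler–Lagrange equation in scalar form. -/
lemma hasDerivAt_deriv_speedFactor (hγ : IsPlanarFrenetCurve ρ I γ N B κ) (hI : IsOpen I)
    (hcrit : IsCriticalCurve ρ μ I γ N κ) {s : ℝ} (hs : s ∈ I) :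
    HasDerivAt (deriv (speedFactor μ κ)) (κ s * expFactor μ κ s - ρ * speedFactor μ κ s) s := by
  have hf := hasDerivAt_of_contDiffOn hI
    ((hγ.contDiffOn_speedFactor (μ := μ)).deriv_of_isOpen hI (m := ∞) (by simp)) hs
  have hJ : HasDerivAt (fieldJ ρ μ γ N κ) _ s :=
    ((hf.smul (hγ.hasDerivAt_normal hI hs)).sub ((hγ.hasDerivAt_expFactor (μ := μ) hI hs).smul
      (hγ.hasDerivAt_velocity hI hs))).congr_of_eventuallyEq
      (Filter.eventually_of_mem (hI.mem_nhds hs) fun r hr => hγ.fieldJ_eq hI hr)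
  have hE := congrArg (fun v => form ρ v (N s)) (hcrit s hs)
  have hTN : form ρ (deriv γ s) (N s) = 0 := by rw [form_comm, hγ.normal_orthogonal s hs]
  have hxN : ρ * form ρ (γ s) (N s) = 0 := by
    rcases eq_or_ne ρ 0 with h0 | h0
    · rw [h0, zero_mul]
    · rw [form_comm, (hγ.normal_tangent s hs).1.2 h0, mul_zero]
  simp only [fieldE, covDeriv, tangProj, hJ.deriv, fieldK, form_add_left, form_sub_left,
    form_smul_left, form_zero_left, hTN, hγ.normal_unit s hs] at hE
  refine hf.congr_deriv ?_
  linear_combination hE + (deriv (deriv (speedFactor μ κ)) s * form ρ (N s) (γ s)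
    - κ s * expFactor μ κ s * form ρ (N s) (γ s) - expFactor μ κ s
    + expFactor μ κ s * ρ * form ρ (γ s) (γ s)) * hxN

lemma hasDerivAt_conservedVector (hγ : IsPlanarFrenetCurve ρ I γ N B κ) (hI : IsOpen I)
    (hcrit : IsCriticalCurve ρ μ I γ N κ) {s : ℝ} (hs : s ∈ I) :
    HasDerivAt (conservedVector ρ μ γ N κ) 0 s := by
  refine (((((hγ.hasDerivAt_speedFactor (μ := μ) hI hs).const_mul ρ).smul
    (hγ.hasDerivAt_curve hI hs)).add ((hγ.hasDerivAt_deriv_speedFactor hI hcrit hs).smul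
    (hγ.hasDerivAt_velocity hI hs))).add ((hγ.hasDerivAt_expFactor (μ := μ) hI hs).smul
    (hγ.hasDerivAt_normal hI hs))).congr_deriv ?_
  module

lemma mul_form_self (hγ : IsPlanarFrenetCurve ρ I γ N B κ) {s : ℝ} (hs : s ∈ I) (h0 : ρ ≠ 0) :
    ρ * form ρ (γ s) (γ s) = 1 := form_self_of_mem h0 (hγ.mem s hs).1

lemma mul_form_curve_velocity (hγ : IsPlanarFrenetCurve ρ I γ N B κ) (hI : IsOpen I) {s : ℝ}
    (hs : s ∈ I) : ρ * form ρ (γ s) (deriv γ s) = 0 := by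
  rcases eq_or_ne ρ 0 with h0 | h0
  · rw [h0, zero_mul]
  · rw [form_comm, (hγ.isTangent_velocity hI hs).2 h0, mul_zero]

lemma mul_form_curve_normal (hγ : IsPlanarFrenetCurve ρ I γ N B κ) {s : ℝ} (hs : s ∈ I) :
    ρ * form ρ (γ s) (N s) = 0 := by
  rcases eq_or_ne ρ 0 with h0 | h0
  · rw [h0, zero_mul]
  · rw [form_comm, (hγ.normal_tangent s hs).1.2 h0, mul_zero]

lemma form_velocity_conservedVector (hγ : IsPlanarFrenetCurve ρ I γ N B κ) (hI : IsOpen I) {s : ℝ}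
    (hs : s ∈ I) :
    form ρ (deriv γ s) (conservedVector ρ μ γ N κ s) = deriv (speedFactor μ κ) s := by
  have h1 := hγ.mul_form_curve_velocity hI hs
  simp only [conservedVector, form_add_right, form_smul_right, hγ.unit_speed s hs,
    form_comm ρ (deriv γ s) (N s), hγ.normal_orthogonal s hs, form_comm ρ (deriv γ s) (γ s)]
  linear_combination speedFactor μ κ s * h1

lemma form_normal_conservedVector (hγ : IsPlanarFrenetCurve ρ I γ N B κ) {s : ℝ} (hs : s ∈ I) :
    form ρ (N s) (conservedVector ρ μ γ N κ s) = expFactor μ κ s := by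
  have h1 := hγ.mul_form_curve_normal hs
  simp only [conservedVector, form_add_right, form_smul_right, hγ.normal_unit s hs,
    hγ.normal_orthogonal s hs, form_comm ρ (N s) (γ s)]
  linear_combination speedFactor μ κ s * h1

lemma form_curve_conservedVector (hγ : IsPlanarFrenetCurve ρ I γ N B κ) (hI : IsOpen I) {s : ℝ}
    (hs : s ∈ I) (h0 : ρ ≠ 0) :
    form ρ (γ s) (conservedVector ρ μ γ N κ s) = speedFactor μ κ s := by
  have h1 := (hγ.isTangent_velocity hI hs).2 h0
  have h2 := (hγ.normal_tangent s hs).1.2 h0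
  have h3 := hγ.mul_form_self hs h0
  simp only [conservedVector, form_add_right, form_smul_right, form_comm ρ (γ s) (deriv γ s),
    form_comm ρ (γ s) (N s), h1, h2]
  linear_combination speedFactor μ κ s * h3

lemma form_curve_binormal (hγ : IsPlanarFrenetCurve ρ I γ N B κ) (hI : IsOpen I) {s : ℝ}
    (hs : s ∈ I) : form ρ (γ s) (B s) = 0 := by
  rw [hγ.binormal_eq_smul_single hI hs, form_smul_right]
  simp [form, (hγ.mem s hs).2]

lemma form_conservedVector_binormal (hγ : IsPlanarFrenetCurve ρ I γ N B κ) (hI : IsOpen I) {s : ℝ}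
    (hs : s ∈ I) : form ρ (conservedVector ρ μ γ N κ s) (B s) = 0 := by
  simp only [conservedVector, form_add_left, form_smul_left, hγ.form_curve_binormal hI hs,
    form_comm ρ (deriv γ s) (B s), form_comm ρ (N s) (B s), (hγ.binormal_orthogonal s hs).1,
    (hγ.binormal_orthogonal s hs).2]
  ring

lemma form_conservedVector_self_add (hγ : IsPlanarFrenetCurve ρ I γ N B κ) (hI : IsOpen I) {s : ℝ}
    (hs : s ∈ I) :
    form ρ (conservedVector ρ μ γ N κ s) (conservedVector ρ μ γ N κ s) =
      expFactor μ κ s ^ 2 + deriv (speedFactor μ κ) s ^ 2 + ρ * speedFactor μ κ s ^ 2 := by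
  have h1 := hγ.form_velocity_conservedVector (μ := μ) hI hs
  have h2 := hγ.form_normal_conservedVector (μ := μ) hs
  have h3 : ρ * form ρ (γ s) (conservedVector ρ μ γ N κ s) = ρ * speedFactor μ κ s := by
    rcases eq_or_ne ρ 0 with h0 | h0
    · rw [h0, zero_mul, zero_mul]
    · rw [hγ.form_curve_conservedVector hI hs h0]
  set w := conservedVector ρ μ γ N κ s with hw
  nth_rewrite 1 [hw]
  simp only [conservedVector, form_add_left, form_smul_left, h1, h2]
  linear_combination speedFactor μ κ s * h3

lemma form_conservedVector_self (hγ : IsPlanarFrenetCurve ρ I γ N B κ) (hI : IsOpen I) {s : ℝ}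
    (hs : s ∈ I) :
    form ρ (conservedVector ρ μ γ N κ s) (conservedVector ρ μ γ N κ s) =
      firstIntegral ρ μ κ s := by
  rw [hγ.form_conservedVector_self_add hI hs, hγ.deriv_speedFactor hI hs, firstIntegral,
    expFactor, speedFactor, two_mul, Real.exp_add]
  ring

/-- A critical curve determines an infinitesimal rotation that restricts to `fieldI` along it. -/
lemma exists_isRotationData (hγ : IsPlanarFrenetCurve ρ I γ N B κ) (hI : IsOpen I)
    (hIc : I.OrdConnected) (hne : I.Nonempty) (hcrit : IsCriticalCurve ρ μ I γ N κ) :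
    ∃ (w B₀ : V) (c : ℝ), IsRotationData ρ w B₀ c ∧ ∀ s ∈ I, B s = B₀ ∧
      conservedVector ρ μ γ N κ s = w ∧ form ρ (γ s) w + c = speedFactor μ κ s := by
  obtain ⟨r, hr⟩ := hne
  have hw : ∀ s ∈ I, conservedVector ρ μ γ N κ s = conservedVector ρ μ γ N κ r := fun s hs =>
    eqOn_const_of_hasDerivAt hI hIc (fun x hx => hγ.hasDerivAt_conservedVector hI hcrit hx) hs hr
  have hB : ∀ s ∈ I, B s = B r := fun s hs =>
    eqOn_const_of_hasDerivAt hI hIc (fun x hx => hγ.hasDerivAt_binormal hI hx) hs hr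
  set w := conservedVector ρ μ γ N κ r with hwr
  have hc : ∀ s ∈ I, speedFactor μ κ s - form ρ (γ s) w = speedFactor μ κ r - form ρ (γ r) w := by
    intro s hs
    refine eqOn_const_of_hasDerivAt hI hIc
      (u := fun s => speedFactor μ κ s - form ρ (γ s) w) (fun x hx => ?_) hs hr
    refine ((hγ.hasDerivAt_speedFactor hI hx).sub ((hγ.hasDerivAt_curve hI hx).form ρ
      (hasDerivAt_const x w))).congr_deriv ?_
    have := hγ.form_velocity_conservedVector (μ := μ) hI hx
    rw [hw x hx] at this
    rw [this, form_zero_right]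
    ring
  refine ⟨w, B r, speedFactor μ κ r - form ρ (γ r) w, ⟨?_, ?_, ?_, ?_, ?_⟩, fun s hs =>
    ⟨hB s hs, hw s hs, ?_⟩⟩
  · exact hγ.form_conservedVector_binormal hI hr
  · exact hγ.binormal_unit r hr
  · intro h0
    simp [hwr, conservedVector, (hγ.mem r hr).1.1 h0, (hγ.isTangent_velocity hI hr).1 h0,
      (hγ.normal_tangent r hr).1.1 h0]
  · exact (hγ.binormal_tangent r hr).1
  · intro h0
    rw [hγ.form_curve_conservedVector hI hr h0, sub_self]
  · rw [← hc s hs]; ring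

end IsPlanarFrenetCurve

variable {B₀ : V}

/-! ### Fixed geodesics and fixed planes -/

lemma IsTangent.smul {x v : V} (h : IsTangent ρ x v) (r : ℝ) : IsTangent ρ x (r • v) :=
  ⟨fun h0 => by simp [h.1 h0], fun h0 => by rw [form_smul_left, h.2 h0, mul_zero]⟩

lemma fixesGeodesic_of_axis {φ : ℝ → V → V}
    (hφ : ∀ t, ∀ x ∈ M3 ρ, φ t x = rotFlow ρ w B₀ c t x) {q e : V} (hq : q ∈ M3 ρ)
    (hqe : IsTangent ρ q e) (hee : form ρ e e = 1) (hqw : form ρ q w + c = 0)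
    (hqB : form ρ q B₀ = 0) (hew : form ρ e w = 0) (heB : form ρ e B₀ = 0)
    (hc : ρ ≠ 0 → c = 0) : FixesGeodesic ρ φ := by
  refine ⟨_, isGeodesic_geodesicCurve hq hqe hee, fun t s => ?_⟩
  rw [hφ t _ (geodesicCurve_mem hq hqe hee s)]
  apply rotFlow_eq_self
  · rw [form_add_left, form_smul_left, form_smul_left, hew]
    rcases eq_or_ne ρ 0 with rfl | h0
    · simpa [cosK] using hqw
    · rw [hc h0, add_zero] at hqw ⊢
      rw [hqw]; ring
  · rw [form_add_left, form_smul_left, form_smul_left, hqB, heB]; ring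

/-- In the elliptic case `⟨w, w⟩ > 0` the flow fixes the geodesic cut out by the equations
`⟨x, w⟩ + c = 0` and `⟨x, B₀⟩ = 0`. -/
lemma IsPlanarFrenetCurve.fixesGeodesic (hγ : IsPlanarFrenetCurve ρ I γ N B κ) (hI : IsOpen I)
    (hμ : μ ≠ 0) (hd : IsRotationData ρ w B₀ c) {s : ℝ} (hs : s ∈ I) (hB : B s = B₀)
    (hw : conservedVector ρ μ γ N κ s = w) (hf : form ρ (γ s) w + c = speedFactor μ κ s)
    (ha : 0 < form ρ w w) {φ : ℝ → V → V}
    (hφ : ∀ t, ∀ x ∈ M3 ρ, φ t x = rotFlow ρ w B₀ c t x) : FixesGeodesic ρ φ := by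
  have hTw : form ρ (deriv γ s) w = deriv (speedFactor μ κ) s := by
    rw [← hw]; exact hγ.form_velocity_conservedVector hI hs
  have hNw : form ρ (N s) w = expFactor μ κ s := by
    rw [← hw]; exact hγ.form_normal_conservedVector hs
  have haw : form ρ w w = expFactor μ κ s ^ 2 + deriv (speedFactor μ κ) s ^ 2 +
      ρ * speedFactor μ κ s ^ 2 := by
    rw [← hw]; exact hγ.form_conservedVector_self_add hI hs
  have hh : expFactor μ κ s ≠ 0 := mul_ne_zero hμ (Real.exp_pos _).ne'
  have hTB : form ρ (deriv γ s) B₀ = 0 := by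
    rw [← hB, form_comm]; exact (hγ.binormal_orthogonal s hs).1
  have hNB : form ρ (N s) B₀ = 0 := by
    rw [← hB, form_comm]; exact (hγ.binormal_orthogonal s hs).2
  have hxB : form ρ (γ s) B₀ = 0 := by rw [← hB]; exact hγ.form_curve_binormal hI hs
  have hTT := hγ.unit_speed s hs
  have hNN := hγ.normal_unit s hs
  have hNT := hγ.normal_orthogonal s hs
  have htT := hγ.isTangent_velocity hI hs
  have htN := (hγ.normal_tangent s hs).1
  have hxM := (hγ.mem s hs).1
  set T := deriv γ s
  set n := N s
  set x := γ s
  set f := speedFactor μ κ s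
  set f' := deriv (speedFactor μ κ) s
  set h := expFactor μ κ s
  set m := h ^ 2 + f' ^ 2 with hm
  have hm0 : 0 < m := by positivity
  have hsm : √m ^ 2 = m := Real.sq_sqrt hm0.le
  have hsm0 : 0 < √m := Real.sqrt_pos.2 hm0
  -- a unit vector of `span {T, N}` orthogonal to `w`
  set e : V := (√m)⁻¹ • (h • T - f' • n) with he
  have hee : form ρ e e = 1 := by
    simp only [he, form_smul_left, form_smul_right, form_sub_left, form_sub_right, hTT, hNN, hNT,
      form_comm ρ T n]
    field_simp
    rw [hsm, hm]
    ring
  have hew : form ρ e w = 0 := by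
    simp only [he, form_smul_left, form_sub_left, hTw, hNw]
    ring
  have heB : form ρ e B₀ = 0 := by
    simp only [he, form_smul_left, form_sub_left, hTB, hNB]
    ring
  -- moving from `x` in the direction of the part of `w` tangent to the space form, one reaches a
  -- zero `p` of `⟨p, w⟩ + c`
  set p : V := x - (f / m) • (f' • T + h • n) with hp
  have hpw : form ρ p w + c = 0 := by
    simp only [hp, form_smul_left, form_sub_left, form_add_left, hTw, hNw]
    have : f / m * (f' * f' + h * h) = f := by field_simp; rw [hm]; ring
    linear_combination hf - this
  have hpB : form ρ p B₀ = 0 := by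
    simp only [hp, form_smul_left, form_sub_left, form_add_left, hTB, hNB, hxB]
    ring
  have hpe : ρ ≠ 0 → form ρ e p = 0 := by
    intro h0
    simp only [he, hp, form_smul_left, form_sub_left, form_sub_right, form_add_right,
      form_smul_right, hTT, hNN, hNT, form_comm ρ T n, htT.2 h0, htN.2 h0]
    ring
  rcases eq_or_ne ρ 0 with h0 | h0
  · refine fixesGeodesic_of_axis hφ (q := p) (e := e) ⟨fun _ => ?_, fun h => absurd h0 h,
      fun h => absurd h0 h.ne⟩ ⟨fun _ => ?_, fun h => absurd h0 h⟩ hee hpw hpB hew heB hd.const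
    · simp [hp, hxM.1 h0, htT.1 h0, htN.1 h0]
    · simp [he, htT.1 h0, htN.1 h0]
  · have hc := hd.const h0
    rw [hc, add_zero] at hpw
    have hpp : ρ * form ρ p p = form ρ w w / m := by
      have h1 := form_self_of_mem h0 hxM
      simp only [hp, form_smul_left, form_sub_left, form_sub_right, form_add_left, form_add_right,
        form_smul_right, hTT, hNN, hNT, form_comm ρ T n, htT.2 h0, htN.2 h0, form_comm ρ x T,
        form_comm ρ x n]
      have h2 : (f / m) ^ 2 * (h ^ 2 + f' ^ 2) = f ^ 2 / m := by rw [← hm]; field_simp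
      rw [haw, add_div, div_self hm0.ne']
      linear_combination h1 + ρ * h2
    set r := √(form ρ w w / m) with hr
    have hr0 : 0 < r := Real.sqrt_pos.2 (div_pos ha hm0)
    have hrr : r ^ 2 = form ρ w w / m := Real.sq_sqrt (div_pos ha hm0).le
    -- the sign puts the point on the upper sheet if `ρ < 0`
    obtain ⟨σ, hσ, hσp⟩ : ∃ σ : ℝ, σ ^ 2 = 1 ∧ (ρ < 0 → 0 < σ * p 3) := by
      rcases lt_or_ge 0 (p 3) with h3 | h3
      · exact ⟨1, by norm_num, fun _ => by linarith⟩
      · refine ⟨-1, by norm_num, fun hneg => ?_⟩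
        rcases h3.lt_or_eq with h3 | h3
        · linarith
        · exfalso
          have h4 : 0 < ρ * form ρ p p := by rw [hpp]; exact div_pos ha hm0
          rw [form, h3] at h4
          nlinarith [mul_self_nonneg (p 0), mul_self_nonneg (p 1), mul_self_nonneg (p 2)]
    refine fixesGeodesic_of_axis hφ (q := (σ * r⁻¹) • p) (e := e)
      ⟨fun h => absurd h h0, fun _ => ?_, fun hneg => ?_⟩ ⟨fun h => absurd h h0, fun _ => ?_⟩ hee
      ?_ ?_ hew heB hd.const
    · rw [form_smul_left, form_smul_right, eq_div_iff h0]
      calc σ * r⁻¹ * (σ * r⁻¹ * form ρ p p) * ρ = σ ^ 2 * (r⁻¹) ^ 2 * (ρ * form ρ p p) := by ring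
        _ = 1 := by rw [hσ, hpp, ← hrr]; field_simp
    · have := mul_pos (inv_pos.2 hr0) (hσp hneg)
      simp only [Pi.smul_apply, smul_eq_mul]
      linarith
    · rw [form_smul_right, hpe h0, mul_zero]
    · rw [form_smul_left, hpw, hc]; ring
    · rw [form_smul_left, hpB, mul_zero]

lemma IsRotationData.fixesPlane (hd : IsRotationData ρ w B₀ c) (hρ : ρ ≠ 0) {x : V}
    (hxw : form ρ x w ≠ 0) (hxB : form ρ x B₀ = 0) {φ : ℝ → V → V}
    (hφ : ∀ t, ∀ x ∈ M3 ρ, φ t x = rotFlow ρ w B₀ c t x) : FixesPlane ρ φ := by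
  let F : V →ₗ[ℝ] ℝ × ℝ :=
    { toFun := fun y => (form ρ y w, form ρ y B₀)
      map_add' := fun y z => by simp only [form_add_left, Prod.mk_add_mk]
      map_smul' := fun r y => by
        simp only [form_smul_left, RingHom.id_apply, Prod.smul_mk, smul_eq_mul] }
  have hF : Function.Surjective F := by
    rintro ⟨a, b⟩
    refine ⟨(a / form ρ x w) • x + b • B₀, Prod.ext ?_ ?_⟩
    · change form ρ ((a / form ρ x w) • x + b • B₀) w = a
      rw [form_add_left, form_smul_left, form_smul_left, hd.form_B_w]
      field_simp
      ring
    · change form ρ ((a / form ρ x w) • x + b • B₀) B₀ = b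
      rw [form_add_left, form_smul_left, form_smul_left, hd.form_B_B, hxB]
      ring
  refine ⟨LinearMap.ker F, rotLin ρ w B₀, ?_, fun t y hy => ?_, fun t y hy => ?_⟩
  · have h1 := F.finrank_range_add_finrank_ker
    rw [LinearMap.range_eq_top.2 hF, finrank_top] at h1
    simp only [Module.finrank_prod, Module.finrank_self, Module.finrank_fin_fun] at h1
    omega
  · rw [hφ t y hy, rotFlow, hd.const hρ, zero_smul, add_zero]
  · have h1 : form ρ y w = 0 := congrArg Prod.fst (LinearMap.mem_ker.1 hy)
    have h2 : form ρ y B₀ = 0 := congrArg Prod.snd (LinearMap.mem_ker.1 hy)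
    rw [rotLin_apply, h1, h2]
    module

/-! ### The surface swept out by the curve -/

/-- The map `(s, t) ↦ u s + g s (S t B₀ - D t w)`, with `S = sinK ⟨w, w⟩` and `D = verK ⟨w, w⟩`. Both
the swept out surface and its unit normal have this form. -/
def sweep (ρ : ℝ) (w B₀ : V) (u : ℝ → V) (g : ℝ → ℝ) (p : ℝ × ℝ) : V :=
  u p.1 + g p.1 • (sinK (form ρ w w) p.2 • B₀ - verK (form ρ w w) p.2 • w)

lemma hasFDerivAt_sweep {u : ℝ → V} {g : ℝ → ℝ} {u' : V} {g' s : ℝ} (hu : HasDerivAt u u' s)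
    (hg : HasDerivAt g g' s) (t : ℝ) : HasFDerivAt (sweep ρ w B₀ u g)
      ((ContinuousLinearMap.fst ℝ ℝ ℝ).smulRight
        (u' + g' • (sinK (form ρ w w) t • B₀ - verK (form ρ w w) t • w)) +
      (ContinuousLinearMap.snd ℝ ℝ ℝ).smulRight
        (g s • (cosK (form ρ w w) t • B₀ - sinK (form ρ w w) t • w))) (s, t) := by
  have h2 := ((hasDerivAt_sinK (form ρ w w) t).smul_const B₀).sub
    ((hasDerivAt_verK (form ρ w w) t).smul_const w)
  have hu1 := hu.hasFDerivAt.comp (s, t) (hasFDerivAt_fst (𝕜 := ℝ) (p := (s, t)))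
  have hg1 := hg.hasFDerivAt.comp (s, t) (hasFDerivAt_fst (𝕜 := ℝ) (p := (s, t)))
  have h3 := h2.hasFDerivAt.comp (s, t) (hasFDerivAt_snd (𝕜 := ℝ) (p := (s, t)))
  refine (hu1.add (hg1.smul h3)).congr_fderiv ?_
  ext <;> simp

lemma contDiffOn_sweep {u : ℝ → V} {g : ℝ → ℝ} {U : Set (ℝ × ℝ)} (hU : ∀ p ∈ U, p.1 ∈ I)
    (hu : ContDiffOn ℝ ∞ u I) (hg : ContDiffOn ℝ ∞ g I) :
    ContDiffOn ℝ ∞ (sweep ρ w B₀ u g) U := by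
  have h1 : ContDiffOn ℝ ∞ (fun p : ℝ × ℝ => u p.1) U := hu.comp contDiffOn_fst hU
  have h2 : ContDiffOn ℝ ∞ (fun p : ℝ × ℝ => g p.1) U := hg.comp contDiffOn_fst hU
  have h3 : ContDiff ℝ ∞ fun p : ℝ × ℝ =>
      sinK (form ρ w w) p.2 • B₀ - verK (form ρ w w) p.2 • w :=
    (((contDiff_sinK _).comp contDiff_snd).smul contDiff_const).sub
      (((contDiff_verK _).comp contDiff_snd).smul contDiff_const)
  exact h1.add (h2.smul h3.contDiffOn)

lemma IsRotationData.rotLin_B (hd : IsRotationData ρ w B₀ c) (t : ℝ) :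
    rotLin ρ w B₀ t B₀ = cosK (form ρ w w) t • B₀ - sinK (form ρ w w) t • w := by
  rw [rotLin_apply, hd.form_B_w, hd.form_B_B]
  module

lemma rotLin_of_form_B_eq_zero {v : V} (hv : form ρ v B₀ = 0) (t : ℝ) : rotLin ρ w B₀ t v =
    v + form ρ v w • (sinK (form ρ w w) t • B₀ - verK (form ρ w w) t • w) := by
  rw [rotLin_apply, hv]
  module

lemma rotFlow_of_form_B_eq_zero {x : V} (hx : form ρ x B₀ = 0) (t : ℝ) : rotFlow ρ w B₀ c t x =
    x + (form ρ x w + c) • (sinK (form ρ w w) t • B₀ - verK (form ρ w w) t • w) := by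
  rw [rotFlow, rotLin_of_form_B_eq_zero hx]
  module

lemma IsRotationData.isTangent_rotLin (hd : IsRotationData ρ w B₀ c) {x v : V}
    (hv : IsTangent ρ x v) (t : ℝ) : IsTangent ρ (rotFlow ρ w B₀ c t x) (rotLin ρ w B₀ t v) := by
  refine ⟨fun h0 => ?_, fun h0 => ?_⟩
  · simp [rotLin_apply, hv.1 h0, hd.w_three h0, hd.B_three h0]
  · rw [rotFlow, hd.const h0, zero_smul, add_zero, hd.form_rotLin, hv.2 h0]

lemma speedFactor_ne_zero {s : ℝ} (hk : κ s ≠ 0) (h : κ s ≠ μ) : speedFactor μ κ s ≠ 0 := by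
  refine mul_ne_zero (fun h0 => h ?_) (Real.exp_pos _).ne'
  field_simp at h0
  linarith

/-- The surface swept out by the curve under the flow has constant astigmatism: its coordinate curves
are lines of curvature, with principal curvatures `κ` and `-h / f` for the factors
`h = expFactor μ κ` and `f = speedFactor μ κ`. -/
lemma IsPlanarFrenetCurve.isConstantAstigmatism (hγ : IsPlanarFrenetCurve ρ I γ N B κ)
    (hI : IsOpen I) (hμ : μ ≠ 0) (hd : IsRotationData ρ w B₀ c)
    (hdata : ∀ s ∈ I, B s = B₀ ∧ conservedVector ρ μ γ N κ s = w ∧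
      form ρ (γ s) w + c = speedFactor μ κ s) {φ : ℝ → V → V}
    (hφ : ∀ t, ∀ x ∈ M3 ρ, φ t x = rotFlow ρ w B₀ c t x) :
    IsConstantAstigmatism ρ ({s | s ∈ I ∧ κ s ≠ μ} ×ˢ Set.univ) (evolution φ γ) (1 / μ) := by
  set U : Set (ℝ × ℝ) := {s | s ∈ I ∧ κ s ≠ μ} ×ˢ Set.univ with hU
  have hUI : ∀ p ∈ U, p.1 ∈ I := fun p hp => hp.1.1
  have hUopen : IsOpen U :=
    (hγ.smooth_curvature.continuousOn.isOpen_inter_preimage hI isOpen_ne).prod isOpen_univ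
  have hTw : ∀ s ∈ I, form ρ (deriv γ s) w = deriv (speedFactor μ κ) s := fun s hs => by
    rw [← (hdata s hs).2.1]; exact hγ.form_velocity_conservedVector hI hs
  have hNw : ∀ s ∈ I, form ρ (N s) w = expFactor μ κ s := fun s hs => by
    rw [← (hdata s hs).2.1]; exact hγ.form_normal_conservedVector hs
  have hTB : ∀ s ∈ I, form ρ (deriv γ s) B₀ = 0 := fun s hs => by
    rw [← (hdata s hs).1, form_comm]; exact (hγ.binormal_orthogonal s hs).1
  have hNB : ∀ s ∈ I, form ρ (N s) B₀ = 0 := fun s hs => by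
    rw [← (hdata s hs).1, form_comm]; exact (hγ.binormal_orthogonal s hs).2
  have hxB : ∀ s ∈ I, form ρ (γ s) B₀ = 0 := fun s hs => by
    rw [← (hdata s hs).1]; exact hγ.form_curve_binormal hI hs
  have hmem : ∀ p ∈ U, evolution φ γ p ∈ M3 ρ := fun p hp => by
    rw [evolution, hφ _ _ (hγ.mem _ (hUI p hp)).1]
    exact hd.rotFlow_mem _ (hγ.mem _ (hUI p hp)).1
  have hXeq : ∀ p ∈ U, evolution φ γ p = rotFlow ρ w B₀ c p.2 (γ p.1) := fun p hp =>
    hφ _ _ (hγ.mem _ (hUI p hp)).1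
  have hX : ∀ p ∈ U, evolution φ γ p = sweep ρ w B₀ γ (speedFactor μ κ) p := fun p hp => by
    rw [hXeq p hp, rotFlow_of_form_B_eq_zero (hxB _ (hUI p hp)), (hdata _ (hUI p hp)).2.2, sweep]
  have hη : ∀ p ∈ U, sweep ρ w B₀ N (expFactor μ κ) p = rotLin ρ w B₀ p.2 (N p.1) := fun p hp => by
    rw [rotLin_of_form_B_eq_zero (hNB _ (hUI p hp)), hNw _ (hUI p hp), sweep]
  -- the differentials of the surface and of its unit normal
  have hdX : ∀ p ∈ U, ∀ v : ℝ × ℝ, fderiv ℝ (evolution φ γ) p v =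
      v.1 • rotLin ρ w B₀ p.2 (deriv γ p.1) +
        v.2 • speedFactor μ κ p.1 • rotLin ρ w B₀ p.2 B₀ := by
    intro p hp v
    have h1 : evolution φ γ =ᶠ[nhds p] sweep ρ w B₀ γ (speedFactor μ κ) :=
      Filter.eventually_of_mem (hUopen.mem_nhds hp) hX
    have h2 := hasFDerivAt_sweep (ρ := ρ) (w := w) (B₀ := B₀)
      (hγ.hasDerivAt_curve hI (hUI p hp)) (hγ.hasDerivAt_speedFactor (μ := μ) hI (hUI p hp)) p.2
    rw [h1.fderiv_eq, h2.fderiv, rotLin_of_form_B_eq_zero (hTB _ (hUI p hp)), hTw _ (hUI p hp),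
      hd.rotLin_B]
    rfl
  have hdη : ∀ p ∈ U, ∀ v : ℝ × ℝ, fderiv ℝ (sweep ρ w B₀ N (expFactor μ κ)) p v =
      (v.1 * -κ p.1) • rotLin ρ w B₀ p.2 (deriv γ p.1) +
        v.2 • expFactor μ κ p.1 • rotLin ρ w B₀ p.2 B₀ := by
    intro p hp v
    have h2 := hasFDerivAt_sweep (ρ := ρ) (w := w) (B₀ := B₀)
      (hγ.hasDerivAt_normal hI (hUI p hp)) (hγ.hasDerivAt_expFactor (μ := μ) hI (hUI p hp)) p.2
    rw [h2.fderiv, rotLin_of_form_B_eq_zero (hTB _ (hUI p hp)), hTw _ (hUI p hp), hd.rotLin_B]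
    simp only [add_apply, ContinuousLinearMap.smulRight_apply,
      ContinuousLinearMap.coe_fst', ContinuousLinearMap.coe_snd']
    module
  have hf0 : ∀ p ∈ U, speedFactor μ κ p.1 ≠ 0 := fun p hp =>
    speedFactor_ne_zero (hγ.curvature_ne_zero _ (hUI p hp)) hp.1.2
  have hfst : ContinuousOn (Prod.fst : ℝ × ℝ → ℝ) U := continuousOn_fst
  refine ⟨hUopen, (contDiffOn_sweep hUI hγ.smooth_curve hγ.contDiffOn_speedFactor).congr hX, hmem,
    fun p hp => ?_, sweep ρ w B₀ N (expFactor μ κ), fun p => κ p.1,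
    fun p => -(expFactor μ κ p.1 / speedFactor μ κ p.1), ⟨?_, fun p hp => ?_, fun p hp => ?_,
      fun p hp v => ?_⟩, ?_, ?_, fun p hp => ⟨⟨(1, 0), (0, 1), ?_, ?_, ?_⟩, ?_, ?_, ?_⟩⟩
  · refine (injective_iff_map_eq_zero _).2 fun v hv => ?_
    rw [hdX p hp] at hv
    have h1 := congrArg (fun z => form ρ z (rotLin ρ w B₀ p.2 (deriv γ p.1))) hv
    have h2 := congrArg (fun z => form ρ z (rotLin ρ w B₀ p.2 B₀)) hv
    simp only [form_add_left, form_smul_left, hd.form_rotLin, form_zero_left, hd.form_B_B,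
      hγ.unit_speed _ (hUI p hp), hTB _ (hUI p hp), form_comm ρ B₀ (deriv γ p.1), mul_zero, mul_one,
      add_zero, zero_add] at h1 h2
    exact Prod.ext h1 ((mul_eq_zero.1 h2).resolve_right (hf0 p hp))
  · exact contDiffOn_sweep hUI hγ.smooth_normal hγ.contDiffOn_expFactor
  · rw [hXeq p hp, hη p hp]
    exact hd.isTangent_rotLin (hγ.normal_tangent _ (hUI p hp)).1 _
  · rw [hη p hp, hd.form_rotLin, hγ.normal_unit _ (hUI p hp)]
  · rw [hη p hp, hdX p hp]
    simp only [form_add_right, form_smul_right, hd.form_rotLin, hNB _ (hUI p hp),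
      hγ.normal_orthogonal _ (hUI p hp)]
    ring
  · exact hγ.smooth_curvature.continuousOn.comp hfst hUI
  · exact ((hγ.contDiffOn_expFactor.continuousOn.comp hfst hUI).div
      (hγ.contDiffOn_speedFactor.continuousOn.comp hfst hUI) hf0).neg
  · rw [LinearIndependent.pair_iff]
    intro a b hab
    simpa using hab
  · rw [hdη p hp, hdX p hp, hXeq p hp]
    simp only [one_mul, zero_smul, add_zero, one_smul]
    rw [tangProj_of_isTangent
      ((hd.isTangent_rotLin (hγ.isTangent_velocity hI (hUI p hp)) p.2).smul _)]
    module
  · rw [hdη p hp, hdX p hp, hXeq p hp]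
    have ht : IsTangent ρ (γ p.1) B₀ := by
      rw [← (hdata _ (hUI p hp)).1]; exact hγ.binormal_tangent _ (hUI p hp)
    simp only [zero_mul, zero_smul, zero_add, one_smul]
    rw [tangProj_of_isTangent ((hd.isTangent_rotLin ht p.2).smul _), smul_smul, neg_mul,
      div_mul_cancel₀ _ (hf0 p hp), neg_smul]
  · exact hγ.curvature_ne_zero _ (hUI p hp)
  · exact neg_ne_zero.2 (div_ne_zero (mul_ne_zero hμ (Real.exp_pos _).ne') (hf0 p hp))
  · have hk := hγ.curvature_ne_zero _ (hUI p hp)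
    have he := (Real.exp_pos (μ / κ p.1)).ne'
    simp only [one_div_neg_eq_neg_one_div, one_div_div, speedFactor, expFactor]
    field_simp
    ring

end SpaceForm

end

open SpaceForm

theorem theorem4p1 (ρ μ : ℝ) (hμ : μ ≠ 0)
    (I : Set ℝ) (hI : IsOpen I) (hIc : I.OrdConnected)
    (γ N B : ℝ → SpaceForm.V) (κ : ℝ → ℝ)
    (hγ : IsPlanarFrenetCurve ρ I γ N B κ)
    (hcrit : IsCriticalCurve ρ μ I γ N κ)
    (hκ : ∃ s₁ ∈ I, ∃ s₂ ∈ I, κ s₁ ≠ κ s₂) :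
    (∃ (ξ : SpaceForm.V → SpaceForm.V) (φ : ℝ → SpaceForm.V → SpaceForm.V),
      IsKillingField ρ ξ ∧ (∀ s ∈ I, ξ (γ s) = fieldI μ B κ s) ∧ IsFlow ρ ξ φ) ∧
    ∀ (ξ : SpaceForm.V → SpaceForm.V) (φ : ℝ → SpaceForm.V → SpaceForm.V),
      IsKillingField ρ ξ → (∀ s ∈ I, ξ (γ s) = fieldI μ B κ s) → IsFlow ρ ξ φ →
      IsRotationalSurface ρ φ (evolution φ γ '' (I ×ˢ Set.univ)) ∧
      ((∀ s ∈ I, 0 < firstIntegral ρ μ κ s) → FixesGeodesic ρ φ) ∧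
      IsConstantAstigmatism ρ ({s | s ∈ I ∧ κ s ≠ μ} ×ˢ Set.univ) (evolution φ γ) (1 / μ) := by
  obtain ⟨r, hr, hrμ⟩ : ∃ r ∈ I, κ r ≠ μ := by
    obtain ⟨s₁, h₁, s₂, h₂, hne⟩ := hκ
    by_contra! h
    exact hne ((h s₁ h₁).trans (h s₂ h₂).symm)
  have hf0 : speedFactor μ κ r ≠ 0 := speedFactor_ne_zero (hγ.curvature_ne_zero r hr) hrμ
  obtain ⟨w, B₀, c, hd, hdata⟩ := hγ.exists_isRotationData hI hIc ⟨r, hr⟩ hcrit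
  have hxB : ∀ s ∈ I, form ρ (γ s) B₀ = 0 := fun s hs => by
    rw [← (hdata s hs).1]; exact hγ.form_curve_binormal hI hs
  have hext : ∀ s ∈ I, rotField ρ w B₀ c (γ s) = fieldI μ B κ s := fun s hs => by
    rw [rotField, hxB s hs, (hdata s hs).2.2, zero_smul, sub_zero, fieldI, (hdata s hs).1]
  refine ⟨⟨_, _, hd.isKillingField, hext, hd.isFlow⟩, fun ξ φ hξ hξI hflow => ?_⟩
  have hξeq := hγ.killing_eqOn hI ⟨r, hr⟩ hξ hd.isKillingField
    fun s hs => (hξI s hs).trans (hext s hs).symm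
  have hφ : ∀ t, ∀ x ∈ M3 ρ, φ t x = rotFlow ρ w B₀ c t x := fun t x hx =>
    hd.eq_rotFlow_of_isFlow hξeq hflow t hx
  have hgeo : 0 < form ρ w w → FixesGeodesic ρ φ := fun ha =>
    hγ.fixesGeodesic hI hμ hd hr (hdata r hr).1 (hdata r hr).2.1 (hdata r hr).2.2 ha hφ
  have hgroup := hd.isOneParamIsometryGroup hφ
  have hM : ∀ s ∈ I, γ s ∈ M3 ρ := fun s hs => (hγ.mem s hs).1
  refine ⟨⟨?_, ⟨hgroup, ?_, ?_⟩, fun t => ?_⟩, fun ha => hgeo ?_,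
    hγ.isConstantAstigmatism hI hμ hd hdata hφ⟩
  · rintro _ ⟨p, hp, rfl⟩
    exact hflow.mem _ _ (hM _ hp.1)
  · -- otherwise the velocity of the orbit of `γ r` would vanish
    by_contra! h
    have h1 := hflow.hasDerivAt 0 _ (hM r hr)
    rw [show (fun t => φ t (γ r)) = fun _ => γ r from funext fun t => h t _ (hM r hr),
      hflow.zero _ (hM r hr), hξI r hr] at h1
    have h2 := congrArg (fun v => form ρ v (B r)) (h1.unique (hasDerivAt_const _ _))
    simp only [fieldI, form_smul_left, hγ.binormal_unit r hr, mul_one, form_zero_left] at h2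
    exact hf0 h2
  · rcases lt_or_ge ρ 0 with hρ | hρ
    · refine Or.inr ⟨hρ, hd.fixesPlane hρ.ne (x := γ r) ?_ (hxB r hr) hφ⟩
      rw [← (hdata r hr).2.2, hd.const hρ.ne, add_zero] at hf0
      exact hf0
    · refine Or.inl (hgeo ?_)
      rw [← (hdata r hr).2.1, hγ.form_conservedVector_self_add hI hr]
      have : expFactor μ κ r ≠ 0 := mul_ne_zero hμ (Real.exp_pos _).ne'
      positivity
  · ext y
    constructor
    · rintro ⟨_, ⟨p, hp, rfl⟩, rfl⟩
      exact ⟨(p.1, t + p.2), ⟨hp.1, trivial⟩, hgroup.add t p.2 _ (hM _ hp.1)⟩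
    · rintro ⟨p, hp, rfl⟩
      refine ⟨_, ⟨(p.1, p.2 - t), ⟨hp.1, trivial⟩, rfl⟩, ?_⟩
      simp only [evolution]
      rw [← hgroup.add t (p.2 - t) _ (hM _ hp.1), add_sub_cancel]
  · rw [← (hdata r hr).2.1, hγ.form_conservedVector_self hI hr]
    exact ha r hr
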